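/- All Lie algebras are real and finite dimensional; indices $a,b$ run over $1,2$, $\epsilon_{12}=-\epsilon_{21}=1$, repeated indices are summed, brackets not listed are zero. An *invariant form* on a Lie algebra is a symmetric bilinear form with $\langle[z,x],y\rangle+\langle x,[z,y]\rangle=0$; an *invariant metric* is a nondegenerate one. A *Chern–Simons theory* for a Klein pair $(\mathfrak k,\mathfrak b)$ is a Lie algebra $\mathfrak e$ (the gauge algebra) with an invariant metric and a surjective homomorphism $\pi:\mathfrak e\to\mathfrak k$, with isotropy subalgebra $\pi^{-1}(\mathfrak b)$; it *adds* $\dim\ker\pi$ generators, and it is *central* if $\ker\pi$ is central. If $\mathfrak g$ has an invariant metric and $\mathfrak h$ acts on $\mathfrak g$ by skew-symmetric derivations, the *double extension* $D(\mathfrak g,\mathfrak h)$ is $\mathfrak g\oplus\mathfrak h\oplus\mathfrak h^*$ with the bracket in which $[x,y]=[x,y]_{\mathfrak g}+\langle(\cdot)\,x,y\rangle$ on $\mathfrak g$ (second term in $\mathfrak h^*$), $\mathfrak h$ is a subalgebra acting on $\mathfrak g$ as given and on $\mathfrak h^*$ by the coadjoint action, and $\mathfrak h^*$ commutes with $\mathfrak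 g$ and $\mathfrak h^*$. A *double extension theory* for $(\mathfrak k,\mathfrak b)$ is a Chern–Simons theory with $\mathfrak e=D(\mathfrak g,\mathfrak h)$ and $\ker\pi=\mathfrak h^*$; it is the *coadjoint* one if $\mathfrak g=0$, $\mathfrak h=\mathfrak k$. Let $N(\mathfrak k,\mathfrak b)$ be the minimal number of generators added by a Chern–Simons theory for $(\mathfrak k,\mathfrak b)$, among all extensions whatsoever. The three-dimensional spatially isotropic homogeneous spacetimes are the following Klein pairs. *Kinematical*: $\mathfrak k$ has basis $J,H,B_a,P_a$, $\mathfrak b$ is spanned by $J,B_a$, and $[J,B_a]=\epsilon_{ab}B_b$, $[J,P_a]=\epsilon_{ab}P_b$ hold throughout. *Aristotelian*: $\mathfrak k$ has basis $J,H,P_a$, $\mathfrak b$ is spanned by $J$, and $[J,P_a]=\epsilon_{ab}P_b$. For each of them there is a Chern–Simons theory with the minimal number of added generators, which is the algebra $\mathfrak k$ itself, a central extension, or a double extension, as a last resort the coadjoint extension. In detail: 1. *Limits of (anti-)de Sitter space*, with real parameters $\Lambda,\tau,c$ (flat, carrollian, galilean limit: $\Lambda,\tau,c=0$) and signs $\eta_0$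 ($-1$ lorentzian, $+1$ riemannian), $\eta_1$ ($-1$ anti-de Sitter, $+1$ de Sitter); put $l=-\eta_1\Lambda^2$, $t=-\eta_0\tau^2$: $[B_a,B_b]=-\epsilon_{ab}tc^2J$, $[H,B_a]=t\epsilon_{am}P_m$, $[B_a,P_b]=-\epsilon_{ab}c^2H$, $[H,P_a]=l\epsilon_{am}B_m$, $[P_a,P_b]=-\epsilon_{ab}lc^2J$. (i) If $c\ne0$ ((A)dS, Poincaré, (A)dS–Carroll, Carroll), the invariant forms are exactly $\langle J,J\rangle=-\chi$, $\langle H,J\rangle=-\mu$, $\langle H,H\rangle=-lt\chi$, $\langle B_a,B_b\rangle=c^2t\chi\delta_{ab}$, $\langle P_a,P_b\rangle=c^2l\chi\delta_{ab}$, $\langle B_a,P_b\rangle=c^2\mu\delta_{ab}$ (other products zero), nondegenerate iff $\mu^2-lt\chi^2\neq0$. So $\mathfrak k$ has an invariant metric, and $N=0$. (ii) If $c=0$, the invariant forms are $\langle J,J\rangle=-\chi$, $\langle H,J\rangle=-\mu$, $\langle H,H\rangle=\chi_H$ (other products zero), all degenerate. If $(\Lambda,\tau)\ne(0,0)$ ((A)dS–Galilei,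 Galilei, para-Galilei), there is a central double extension theory adding 2 generators, and $N=2$. If $\Lambda=\tau=0$ (static), there is a central double extension theory adding 1 generator, and $N=1$. 2. *Torsional galilean spacetimes*: $[H,B_a]=\epsilon_{ab}P_b$ and $[H,P_a]=\gamma\epsilon_{ab}B_b+(1+\gamma)P_a$ with $-1<\gamma\le1$ (dS type), or $[H,P_a]=(1+\chi^2)\epsilon_{ab}B_b+2\chi P_a$ with $\chi>0$ (AdS type), or $[H,P_a]=(1+\gamma)P_a-\chi\epsilon_{ab}P_b+\gamma\epsilon_{ab}B_b+\chi B_a$ with $-1\le\gamma\le1$, $\chi>0$ (S12). The invariant forms are those with arbitrary $\langle J,J\rangle,\langle J,H\rangle,\langle H,H\rangle$ and all other products zero, all degenerate. There is no central Chern–Simons theory, with any number of generators; the coadjoint extension is a Chern–Simons theory. It is minimal, $N=6$, for the AdS type and for the dS type and S12 with $\gamma\neq0$. For the dS type and S12 with $\gamma=0$ there is a double extension theory adding 4 generators, and $N=4$. 3. *Carrollian light cone*: $[B_a,P_b]=-\epsilon_{ab}H-\delta_{ab}J$, $[H,P_a]=-P_a$, $[H,B_a]=B_a$. The invariant forms are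 $\langle J,J\rangle=-\langle H,H\rangle=\chi$, $\langle J,H\rangle=\mu$, $\langle B_a,P_b\rangle=-\mu\delta_{ab}+\chi\epsilon_{ab}$ (others zero), nondegenerate iff $\mu\ne0$ or $\chi\neq0$; $N=0$. 4. *Aristotelian static* (no further brackets): the invariant forms are those with arbitrary $\langle J,J\rangle,\langle J,H\rangle,\langle H,H\rangle$ and other products zero, all degenerate; there is a central double extension theory adding 1 generator, and $N=1$. 5. *Torsional static*, $[H,P_a]=P_a$: the invariant forms are as in 4, all degenerate; there is no central Chern–Simons theory, the coadjoint extension is a Chern–Simons theory, and $N=4$. 6. $\mathbb R\times\mathbb H^2$ ($\sigma=-1$) and $\mathbb R\times S^2$ ($\sigma=+1$), $[P_a,P_b]=\sigma\epsilon_{ab}J$: the invariant forms are $\langle J,J\rangle=\chi$, $\langle P_a,P_b\rangle=\sigma\chi\delta_{ab}$, $\langle H,H\rangle=\chi_H$ (others zero), nondegenerate iff $\chi\ne0$ and $\chi_H\neq0$; $N=0$. 7. *A24*, $[P_a,P_b]=\epsilon_{ab}H$: the invariant forms are $\langle J,H\rangle=\chi$, $\langle P_a,P_b\rangle=\chi\delta_{ab}$,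 $\langle J,J\rangle=\chi_J$ (others zero), nondegenerate iff $\chi\neq0$; $N=0$. -/

import Mathlib

/-! ### Klein pairs given by structure constants -/

/-- The bilinear extension of a table of brackets of basis vectors: `br i j k` is the coefficient of
the `k`-th basis vector in the bracket of the `i`-th and the `j`-th one. -/
noncomputable def tableBracket {ι : Type} [Fintype ι] (br : ι → ι → ι → ℝ) (x y : ι → ℝ) : ι → ℝ :=
  fun k => ∑ i, ∑ j, x i * y j * br i j k

/-- A finite-dimensional real Lie algebra with basis indexed by `ι`, given by the structure constants
`br`. The set `iso` of basis vectors spans a subalgebra (the isotropy subalgebra), so that the data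
describe a Klein pair. -/
structure KleinTable (ι : Type) [Fintype ι] where
  br : ι → ι → ι → ℝ
  iso : Set ι
  br_skew : ∀ i j, br i j = -br j i
  jacobi : ∀ x y z : ι → ℝ, tableBracket br x (tableBracket br y z) +
    tableBracket br y (tableBracket br z x) + tableBracket br z (tableBracket br x y) = 0
  iso_closed : ∀ i ∈ iso, ∀ j ∈ iso, ∀ k ∉ iso, br i j k = 0

namespace KleinTable

variable {ι : Type} [Fintype ι]

/-- The Lie algebra of a Klein pair, in coordinates with respect to its basis. -/
def Alg (_ : KleinTable ι) : Type := ι → ℝ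

variable (T : KleinTable ι)

noncomputable instance : AddCommGroup T.Alg := inferInstanceAs (AddCommGroup (ι → ℝ))

noncomputable instance : Module ℝ T.Alg := inferInstanceAs (Module ℝ (ι → ℝ))

noncomputable instance : FiniteDimensional ℝ T.Alg :=
  inferInstanceAs (FiniteDimensional ℝ (ι → ℝ))

noncomputable instance : Bracket T.Alg T.Alg := ⟨tableBracket T.br⟩

theorem bracket_apply (x y : T.Alg) (k : ι) :
    (⁅x, y⁆ : T.Alg) k = ∑ i, ∑ j, x i * y j * T.br i j k := rfl

theorem add_apply (x y : T.Alg) (k : ι) : (x + y) k = x k + y k := rfl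

theorem smul_apply (r : ℝ) (x : T.Alg) (k : ι) : (r • x) k = r * x k := rfl

theorem zero_apply (k : ι) : (0 : T.Alg) k = 0 := rfl

theorem bracket_self (x : T.Alg) : ⁅x, x⁆ = (0 : T.Alg) := by
  funext k
  rw [bracket_apply, zero_apply]
  have h : ∑ i, ∑ j, x i * x j * T.br i j k = -∑ i, ∑ j, x i * x j * T.br i j k := by
    conv_lhs => rw [Finset.sum_comm]
    rw [← Finset.sum_neg_distrib]
    refine Finset.sum_congr rfl fun i _ => ?_
    rw [← Finset.sum_neg_distrib]
    refine Finset.sum_congr rfl fun j _ => ?_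
    rw [T.br_skew j i, Pi.neg_apply]
    ring
  linarith

theorem cyclic (x y z : T.Alg) : ⁅x, ⁅y, z⁆⁆ + ⁅y, ⁅z, x⁆⁆ + ⁅z, ⁅x, y⁆⁆ = (0 : T.Alg) :=
  T.jacobi x y z

theorem bracket_add_left (x y z : T.Alg) : ⁅x + y, z⁆ = (⁅x, z⁆ + ⁅y, z⁆ : T.Alg) := by
  funext k
  simp only [bracket_apply, add_apply, add_mul, Finset.sum_add_distrib]

theorem bracket_add_right (x y z : T.Alg) : ⁅x, y + z⁆ = (⁅x, y⁆ + ⁅x, z⁆ : T.Alg) := by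
  funext k
  simp only [bracket_apply, add_apply, mul_add, add_mul, Finset.sum_add_distrib]

theorem bracket_swap (x y : T.Alg) : ⁅y, x⁆ = (-⁅x, y⁆ : T.Alg) := by
  have h := T.bracket_self (x + y)
  rw [bracket_add_left, bracket_add_right, bracket_add_right, bracket_self, bracket_self,
    zero_add, add_zero] at h
  exact eq_neg_of_add_eq_zero_right h

theorem bracket_smul (r : ℝ) (x y : T.Alg) : ⁅x, r • y⁆ = (r • ⁅x, y⁆ : T.Alg) := by
  funext k
  simp only [bracket_apply, smul_apply, Finset.mul_sum]
  refine Finset.sum_congr rfl fun i _ => Finset.sum_congr rfl fun j _ => ?_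
  ring

noncomputable instance : LieRing T.Alg where
  add_lie := T.bracket_add_left
  lie_add := T.bracket_add_right
  lie_self := T.bracket_self
  leibniz_lie x y z := by
    have h := T.cyclic x y z
    have h1 : (⁅y, ⁅z, x⁆⁆ : T.Alg) = -⁅y, ⁅x, z⁆⁆ := by
      have : (⁅z, x⁆ : T.Alg) = (-1 : ℝ) • ⁅x, z⁆ := by rw [T.bracket_swap x z, neg_one_smul]
      rw [this, T.bracket_smul, neg_one_smul]
    rw [h1, T.bracket_swap ⁅x, y⁆ z] at h
    rw [← sub_eq_zero, ← h]
    abel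

noncomputable instance : LieAlgebra ℝ T.Alg where
  lie_smul := T.bracket_smul

/-- The isotropy subalgebra, spanned by the basis vectors in `iso`. -/
def isotropy : LieSubalgebra ℝ T.Alg where
  carrier := {x | ∀ k ∉ T.iso, x k = 0}
  add_mem' {x y} hx hy k hk := by rw [add_apply, hx k hk, hy k hk, add_zero]
  zero_mem' _ _ := rfl
  smul_mem' r x hx k hk := by rw [smul_apply, hx k hk, mul_zero]
  lie_mem' {x y} hx hy k hk := by
    change (⁅x, y⁆ : T.Alg) k = 0
    rw [bracket_apply]
    refine Finset.sum_eq_zero fun i _ => Finset.sum_eq_zero fun j _ => ?_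
    by_cases hi : i ∈ T.iso
    · by_cases hj : j ∈ T.iso
      · rw [T.iso_closed i hi j hj k hk, mul_zero]
      · rw [hy j hj, mul_zero, zero_mul]
    · rw [hx i hi, zero_mul, zero_mul]

/-- The bilinear form with the given matrix in the basis of the table. -/
noncomputable def form [DecidableEq ι] (M : ι → ι → ℝ) : LinearMap.BilinForm ℝ T.Alg :=
  Matrix.toBilin' (Matrix.of M)

end KleinTable

/-! ### The spacetimes -/

/-- The Levi-Civita symbol in two dimensions, `ε₁₂ = 1` (with indices `0, 1` instead of `1, 2`). -/
def eps (a b : Fin 2) : ℝ := !![0, 1; -1, 0] a b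

/-- The Kronecker symbol. -/
def kron (a b : Fin 2) : ℝ := if a = b then 1 else 0

/-- Generators of a kinematical Lie algebra: rotation, time translation, boosts, spatial
translations. -/
inductive KinGen
  | J
  | H
  | B (a : Fin 2)
  | P (a : Fin 2)
  deriving DecidableEq

/-- Generators of an aristotelian Lie algebra: rotation, time translation, spatial translations. -/
inductive AriGen
  | J
  | H
  | P (a : Fin 2)
  deriving DecidableEq

instance : Fintype KinGen :=
  ⟨{.J, .H, .B 0, .B 1, .P 0, .P 1}, by
    rintro (_ | _ | a | a) <;> try fin_cases a
    all_goals decide⟩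

instance : Fintype AriGen :=
  ⟨{.J, .H, .P 0, .P 1}, by
    rintro (_ | _ | a) <;> try fin_cases a
    all_goals decide⟩

theorem KinGen.sum_eq (f : KinGen → ℝ) :
    ∑ i, f i = f .J + f .H + f (.B 0) + f (.B 1) + f (.P 0) + f (.P 1) := by
  change ∑ i ∈ {.J, .H, .B 0, .B 1, .P 0, .P 1}, f i = _
  rw [Finset.sum_insert (by decide), Finset.sum_insert (by decide), Finset.sum_insert (by decide),
    Finset.sum_insert (by decide), Finset.sum_insert (by decide), Finset.sum_singleton]
  ring

theorem AriGen.sum_eq (f : AriGen → ℝ) :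
    ∑ i, f i = f .J + f .H + f (.P 0) + f (.P 1) := by
  change ∑ i ∈ {.J, .H, .P 0, .P 1}, f i = _
  rw [Finset.sum_insert (by decide), Finset.sum_insert (by decide), Finset.sum_insert (by decide),
    Finset.sum_singleton]
  ring

namespace KinGen

/-- The basis vector of a generator. -/
def vec (i : KinGen) : KinGen → ℝ := fun k => if k = i then 1 else 0

/-- The vector `ε_{am} B_m` (sum over `m`). -/
def epsB (a : Fin 2) : KinGen → ℝ := ∑ m, eps a m • vec (B m)

/-- The vector `ε_{am} P_m` (sum over `m`). -/
def epsP (a : Fin 2) : KinGen → ℝ := ∑ m, eps a m • vec (P m)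

/-- Rotations and boosts. -/
def isotropy : Set KinGen := {J, B 0, B 1}

/-- The matrix of the symmetric bilinear form with `⟨J, J⟩ = jj`, `⟨J, H⟩ = jh`, `⟨H, H⟩ = hh`,
`⟨B_a, B_b⟩ = bb δ_{ab}`, `⟨P_a, P_b⟩ = pp δ_{ab}`, `⟨B_a, P_b⟩ = bp δ_{ab} + bp' ε_{ab}`
and all other products of generators equal to zero. -/
def formMatrix (jj jh hh bb pp bp bp' : ℝ) : KinGen → KinGen → ℝ
  | J, J => jj
  | J, H => jh
  | H, J => jh
  | H, H => hh
  | B a, B b => bb * kron a b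
  | P a, P b => pp * kron a b
  | B a, P b => bp * kron a b + bp' * eps a b
  | P b, B a => bp * kron a b + bp' * eps a b
  | _, _ => 0

/-- The brackets of the (anti-)de Sitter algebra with contraction parameters. The coefficients
are `l = ± Λ²` (upper sign for anti-de Sitter), `t = τ²` and `c = c_i²`. -/
def limitBr (l t c : ℝ) : KinGen → KinGen → KinGen → ℝ
  | J, B a => epsB a
  | B a, J => -epsB a
  | J, P a => epsP a
  | P a, J => -epsP a
  | B a, B b => -(eps a b * (t * c)) • vec J
  | B a, H => -t • epsP a
  | H, B a => t • epsP a
  | B a, P b => -(eps a b * c) • vec H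
  | P b, B a => (eps a b * c) • vec H
  | H, P a => l • epsB a
  | P a, H => -l • epsB a
  | P a, P b => -(eps a b * (l * c)) • vec J
  | _, _ => 0

/-- The brackets of the torsional galilean algebras: `[J, B_a] = ε_{ab} B_b`,
`[J, P_a] = ε_{ab} P_b`, `[H, B_a] = ε_{ab} P_b` and
`[H, P_a] = α ε_{ab} B_b + β P_a + β' ε_{ab} P_b + α' B_a`. -/
def torsionalBr (α β β' α' : ℝ) : KinGen → KinGen → KinGen → ℝ
  | J, B a => epsB a
  | B a, J => -epsB a
  | J, P a => epsP a
  | P a, J => -epsP a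
  | H, B a => epsP a
  | B a, H => -epsP a
  | H, P a => α • epsB a + β • vec (P a) + β' • epsP a + α' • vec (B a)
  | P a, H => -(α • epsB a + β • vec (P a) + β' • epsP a + α' • vec (B a))
  | _, _ => 0

/-- The brackets of the carrollian light cone algebra. -/
def lightConeBr : KinGen → KinGen → KinGen → ℝ
  | J, B a => epsB a
  | B a, J => -epsB a
  | J, P a => epsP a
  | P a, J => -epsP a
  | B a, P b => -(eps a b • vec H + kron a b • vec J)
  | P b, B a => eps a b • vec H + kron a b • vec J
  | H, P a => -vec (P a)
  | P a, H => vec (P a)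
  | H, B a => vec (B a)
  | B a, H => -vec (B a)
  | _, _ => 0

end KinGen

namespace AriGen

/-- The basis vector of a generator. -/
def vec (i : AriGen) : AriGen → ℝ := fun k => if k = i then 1 else 0

/-- The vector `ε_{am} P_m` (sum over `m`). -/
def epsP (a : Fin 2) : AriGen → ℝ := ∑ m, eps a m • vec (P m)

/-- Rotations. -/
def isotropy : Set AriGen := {J}

/-- The matrix of the symmetric bilinear form with `⟨J, J⟩ = jj`, `⟨J, H⟩ = jh`, `⟨H, H⟩ = hh`,
`⟨P_a, P_b⟩ = pp δ_{ab}` and all other products of generators equal to zero. -/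
def formMatrix (jj jh hh pp : ℝ) : AriGen → AriGen → ℝ
  | J, J => jj
  | J, H => jh
  | H, J => jh
  | H, H => hh
  | P a, P b => pp * kron a b
  | _, _ => 0

/-- The brackets `[J, P_a] = ε_{ab} P_b`, `[H, P_a] = h P_a`. -/
def staticBr (h : ℝ) : AriGen → AriGen → AriGen → ℝ
  | J, P a => epsP a
  | P a, J => -epsP a
  | H, P a => h • vec (P a)
  | P a, H => -h • vec (P a)
  | _, _ => 0

/-- The brackets `[J, P_a] = ε_{ab} P_b`, `[P_a, P_b] = ε_{ab} (x J + y H)`. -/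
def curvedBr (x y : ℝ) : AriGen → AriGen → AriGen → ℝ
  | J, P a => epsP a
  | P a, J => -epsP a
  | P a, P b => eps a b • (x • vec J + y • vec H)
  | _, _ => 0

end AriGen

set_option linter.unusedSimpArgs false
set_option linter.unnecessarySeqFocus false

theorem KinGen.limitBr_bracket (l t c : ℝ) (x y : KinGen → ℝ) : tableBracket (KinGen.limitBr l t c) x y = fun k => match k with
    | .J => -(t * c) * (x (.B 0) * y (.B 1) - x (.B 1) * y (.B 0))
        - (l * c) * (x (.P 0) * y (.P 1) - x (.P 1) * y (.P 0))
    | .H => -c * (x (.B 0) * y (.P 1) - x (.B 1) * y (.P 0)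
        - y (.B 0) * x (.P 1) + y (.B 1) * x (.P 0))
    | .B 0 => -(x .J * y (.B 1) - x (.B 1) * y .J) - l * (x .H * y (.P 1) - x (.P 1) * y .H)
    | .B 1 => x .J * y (.B 0) - x (.B 0) * y .J + l * (x .H * y (.P 0) - x (.P 0) * y .H)
    | .P 0 => -(x .J * y (.P 1) - x (.P 1) * y .J) - t * (x .H * y (.B 1) - x (.B 1) * y .H)
    | .P 1 => x .J * y (.P 0) - x (.P 0) * y .J + t * (x .H * y (.B 0) - x (.B 0) * y .H) := by
  funext k
  obtain (_ | _ | a | a) := k <;> (try fin_cases a) <;>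
    simp [tableBracket, KinGen.sum_eq, KinGen.limitBr, KinGen.epsB, KinGen.epsP, KinGen.vec, eps, kron, Fin.sum_univ_two] <;> ring

/-- The table with brackets `KinGen.limitBr` and isotropy subalgebra spanned by `J`, `B_a`. -/
def limitTable (l t c : ℝ) : KleinTable KinGen where
  br := KinGen.limitBr l t c
  iso := KinGen.isotropy
  br_skew := by
    rintro (_ | _ | a | a) (_ | _ | b | b) <;> funext k <;> (try fin_cases a) <;> (try fin_cases b) <;>
      simp [KinGen.limitBr, eps, kron]
  jacobi x y z := by
    simp only [KinGen.limitBr_bracket]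
    funext k
    obtain (_ | _ | a | a) := k <;> (try fin_cases a) <;>
      simp only [Pi.add_apply, Pi.zero_apply, Fin.zero_eta, Fin.mk_one, Fin.isValue] <;> ring
  iso_closed := by
    rintro (_ | _ | a | a) hi (_ | _ | b | b) hj (_ | _ | d | d) hk <;> (try fin_cases d) <;>
      simp_all [KinGen.isotropy, KinGen.limitBr, KinGen.epsB, KinGen.epsP, KinGen.vec, eps, kron, Fin.sum_univ_two]

theorem KinGen.torsionalBr_bracket (α β β' α' : ℝ) (x y : KinGen → ℝ) : tableBracket (KinGen.torsionalBr α β β' α') x y = fun k => match k with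
    | .J => 0
    | .H => 0
    | .B 0 => -(x .J * y (.B 1) - x (.B 1) * y .J) - α * (x .H * y (.P 1) - x (.P 1) * y .H)
        + α' * (x .H * y (.P 0) - x (.P 0) * y .H)
    | .B 1 => x .J * y (.B 0) - x (.B 0) * y .J + α * (x .H * y (.P 0) - x (.P 0) * y .H)
        + α' * (x .H * y (.P 1) - x (.P 1) * y .H)
    | .P 0 => -(x .J * y (.P 1) - x (.P 1) * y .J) - (x .H * y (.B 1) - x (.B 1) * y .H)
        + β * (x .H * y (.P 0) - x (.P 0) * y .H) - β' * (x .H * y (.P 1) - x (.P 1) * y .H)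
    | .P 1 => x .J * y (.P 0) - x (.P 0) * y .J + (x .H * y (.B 0) - x (.B 0) * y .H)
        + β * (x .H * y (.P 1) - x (.P 1) * y .H) + β' * (x .H * y (.P 0) - x (.P 0) * y .H) := by
  funext k
  obtain (_ | _ | a | a) := k <;> (try fin_cases a) <;>
    simp [tableBracket, KinGen.sum_eq, KinGen.torsionalBr, KinGen.epsB, KinGen.epsP, KinGen.vec, eps, kron, Fin.sum_univ_two] <;> ring

/-- The table with brackets `KinGen.torsionalBr` and isotropy subalgebra spanned by `J`, `B_a`. -/
def torsionalTable (α β β' α' : ℝ) : KleinTable KinGen where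
  br := KinGen.torsionalBr α β β' α'
  iso := KinGen.isotropy
  br_skew := by
    rintro (_ | _ | a | a) (_ | _ | b | b) <;> funext k <;> (try fin_cases a) <;> (try fin_cases b) <;>
      simp [KinGen.torsionalBr, eps, kron]
  jacobi x y z := by
    simp only [KinGen.torsionalBr_bracket]
    funext k
    obtain (_ | _ | a | a) := k <;> (try fin_cases a) <;>
      simp only [Pi.add_apply, Pi.zero_apply, Fin.zero_eta, Fin.mk_one, Fin.isValue] <;> ring
  iso_closed := by
    rintro (_ | _ | a | a) hi (_ | _ | b | b) hj (_ | _ | d | d) hk <;> (try fin_cases d) <;>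
      simp_all [KinGen.isotropy, KinGen.torsionalBr, KinGen.epsB, KinGen.epsP, KinGen.vec, eps, kron, Fin.sum_univ_two]

theorem KinGen.lightConeBr_bracket (x y : KinGen → ℝ) : tableBracket KinGen.lightConeBr x y = fun k => match k with
    | .J => -(x (.B 0) * y (.P 0) - x (.P 0) * y (.B 0) + x (.B 1) * y (.P 1)
        - x (.P 1) * y (.B 1))
    | .H => -(x (.B 0) * y (.P 1) - x (.B 1) * y (.P 0)
        - y (.B 0) * x (.P 1) + y (.B 1) * x (.P 0))
    | .B 0 => -(x .J * y (.B 1) - x (.B 1) * y .J) + (x .H * y (.B 0) - x (.B 0) * y .H)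
    | .B 1 => x .J * y (.B 0) - x (.B 0) * y .J + (x .H * y (.B 1) - x (.B 1) * y .H)
    | .P 0 => -(x .J * y (.P 1) - x (.P 1) * y .J) - (x .H * y (.P 0) - x (.P 0) * y .H)
    | .P 1 => x .J * y (.P 0) - x (.P 0) * y .J - (x .H * y (.P 1) - x (.P 1) * y .H) := by
  funext k
  obtain (_ | _ | a | a) := k <;> (try fin_cases a) <;>
    simp [tableBracket, KinGen.sum_eq, KinGen.lightConeBr, KinGen.epsB, KinGen.epsP, KinGen.vec, eps, kron, Fin.sum_univ_two] <;> ring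

/-- The carrollian light cone. -/
def lightCone : KleinTable KinGen where
  br := KinGen.lightConeBr 
  iso := KinGen.isotropy
  br_skew := by
    rintro (_ | _ | a | a) (_ | _ | b | b) <;> funext k <;> (try fin_cases a) <;> (try fin_cases b) <;>
      simp [KinGen.lightConeBr, eps, kron]
  jacobi x y z := by
    simp only [KinGen.lightConeBr_bracket]
    funext k
    obtain (_ | _ | a | a) := k <;> (try fin_cases a) <;>
      simp only [Pi.add_apply, Pi.zero_apply, Fin.zero_eta, Fin.mk_one, Fin.isValue] <;> ring
  iso_closed := by
    rintro (_ | _ | a | a) hi (_ | _ | b | b) hj (_ | _ | d | d) hk <;> (try fin_cases d) <;>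
      simp_all [KinGen.isotropy, KinGen.lightConeBr, KinGen.epsB, KinGen.epsP, KinGen.vec, eps, kron, Fin.sum_univ_two]

theorem AriGen.staticBr_bracket (h : ℝ) (x y : AriGen → ℝ) : tableBracket (AriGen.staticBr h) x y = fun k => match k with
    | .J => 0
    | .H => 0
    | .P 0 => -(x .J * y (.P 1) - x (.P 1) * y .J) + h * (x .H * y (.P 0) - x (.P 0) * y .H)
    | .P 1 => x .J * y (.P 0) - x (.P 0) * y .J + h * (x .H * y (.P 1) - x (.P 1) * y .H) := by
  funext k
  obtain (_ | _ | a) := k <;> (try fin_cases a) <;>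
    simp [tableBracket, AriGen.sum_eq, AriGen.staticBr, AriGen.epsP, AriGen.vec, eps, kron, Fin.sum_univ_two] <;> ring

/-- The table with brackets `AriGen.staticBr` and isotropy subalgebra spanned by `J`. -/
def staticTable (h : ℝ) : KleinTable AriGen where
  br := AriGen.staticBr h
  iso := AriGen.isotropy
  br_skew := by
    rintro (_ | _ | a) (_ | _ | b) <;> funext k <;> (try fin_cases a) <;> (try fin_cases b) <;>
      simp [AriGen.staticBr, eps, kron]
  jacobi x y z := by
    simp only [AriGen.staticBr_bracket]
    funext k
    obtain (_ | _ | a) := k <;> (try fin_cases a) <;>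
      simp only [Pi.add_apply, Pi.zero_apply, Fin.zero_eta, Fin.mk_one, Fin.isValue] <;> ring
  iso_closed := by
    rintro (_ | _ | a) hi (_ | _ | b) hj (_ | _ | d) hk <;>
      simp_all [AriGen.isotropy, AriGen.staticBr, AriGen.epsP, AriGen.vec, eps, kron, Fin.sum_univ_two]

theorem AriGen.curvedBr_bracket (u v : ℝ) (x y : AriGen → ℝ) : tableBracket (AriGen.curvedBr u v) x y = fun k => match k with
    | .J => u * (x (.P 0) * y (.P 1) - x (.P 1) * y (.P 0))
    | .H => v * (x (.P 0) * y (.P 1) - x (.P 1) * y (.P 0))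
    | .P 0 => -(x .J * y (.P 1) - x (.P 1) * y .J)
    | .P 1 => x .J * y (.P 0) - x (.P 0) * y .J := by
  funext k
  obtain (_ | _ | a) := k <;> (try fin_cases a) <;>
    simp [tableBracket, AriGen.sum_eq, AriGen.curvedBr, AriGen.epsP, AriGen.vec, eps, kron, Fin.sum_univ_two] <;> ring

/-- The table with brackets `AriGen.curvedBr` and isotropy subalgebra spanned by `J`. -/
def curvedTable (u v : ℝ) : KleinTable AriGen where
  br := AriGen.curvedBr u v
  iso := AriGen.isotropy
  br_skew := by
    rintro (_ | _ | a) (_ | _ | b) <;> funext k <;> (try fin_cases a) <;> (try fin_cases b) <;>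
      simp [AriGen.curvedBr, eps, kron] <;> ring
  jacobi x y z := by
    simp only [AriGen.curvedBr_bracket]
    funext k
    obtain (_ | _ | a) := k <;> (try fin_cases a) <;>
      simp only [Pi.add_apply, Pi.zero_apply, Fin.zero_eta, Fin.mk_one, Fin.isValue] <;> ring
  iso_closed := by
    rintro (_ | _ | a) hi (_ | _ | b) hj (_ | _ | d) hk <;>
      simp_all [AriGen.isotropy, AriGen.curvedBr, AriGen.epsP, AriGen.vec, eps, kron, Fin.sum_univ_two]

/-- The spacetimes that arise as limits of (anti-)de Sitter space: `η₁ = -1` for anti-de Sitter,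
`η₁ = 1` for de Sitter; `η₀ = -1` for the lorentzian series, `η₀ = 1` for the riemannian one. The
limits are the vanishing of the contraction parameters: `Λ` (flat), `τ` (carrollian), `c`, the
inverse speed of light (galilean). -/
noncomputable def limitSpacetime (η₀ η₁ : ℤˣ) (Λ τ c : ℝ) : KleinTable KinGen :=
  limitTable (-(η₁ : ℤ) * Λ ^ 2) (-(η₀ : ℤ) * τ ^ 2) (c ^ 2)

/-- `[H, P_a] = γ ε_{ab} B_b + (1 + γ) P_a`. -/
noncomputable def torsionalGalileanDS (γ : ℝ) : KleinTable KinGen :=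
  torsionalTable γ (1 + γ) 0 0

/-- `[H, P_a] = (1 + χ²) ε_{ab} B_b + 2 χ P_a`. -/
noncomputable def torsionalGalileanAdS (χ : ℝ) : KleinTable KinGen :=
  torsionalTable (1 + χ ^ 2) (2 * χ) 0 0

/-- `[H, P_a] = (1 + γ) P_a - χ ε_{ab} P_b + γ ε_{ab} B_b + χ B_a`. -/
noncomputable def torsionalGalileanS12 (γ χ : ℝ) : KleinTable KinGen :=
  torsionalTable γ (1 + γ) (-χ) χ

/-- Only `[J, P_a] = ε_{ab} P_b`. -/
noncomputable def aristotelianStatic : KleinTable AriGen := staticTable 0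

/-- `[H, P_a] = P_a`. -/
noncomputable def torsionalStatic : KleinTable AriGen := staticTable 1

/-- `[P_a, P_b] = σ ε_{ab} J`: the product of a line with the hyperbolic plane (`σ = -1`) or with
the sphere (`σ = 1`). -/
noncomputable def lineTimesSurface (σ : ℤˣ) : KleinTable AriGen := curvedTable (σ : ℤ) 0

/-- `[P_a, P_b] = ε_{ab} H`. -/
noncomputable def spacetimeA24 : KleinTable AriGen := curvedTable 0 1

/-! ### Invariant metrics, double extensions and Chern–Simons theories -/

section General

/-- A symmetric bilinear form on a Lie algebra, possibly degenerate, that is invariant under the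
adjoint action: `⟨[z, x], y⟩ = -⟨x, [z, y]⟩`. -/
def IsInvariantForm {k : Type*} [LieRing k] [LieAlgebra ℝ k] (B : LinearMap.BilinForm ℝ k) : Prop :=
  B.IsSymm ∧ B.lieInvariant k

/-- An invariant metric is a nondegenerate invariant symmetric bilinear form. -/
def IsInvariantMetric {k : Type*} [LieRing k] [LieAlgebra ℝ k]
    (B : LinearMap.BilinForm ℝ k) : Prop :=
  IsInvariantForm B ∧ B.Nondegenerate

/-- The input of a double extension: a Lie algebra `g` with an invariant metric, and a Lie algebra
`h` that acts on `g` by derivations which are skew-symmetric for the metric. -/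
structure DoubleExtensionData (g h : Type*) [LieRing g] [LieAlgebra ℝ g] [LieRing h]
    [LieAlgebra ℝ h] where
  form : LinearMap.BilinForm ℝ g
  isMetric : IsInvariantMetric form
  act : h →ₗ⁅ℝ⁆ LieDerivation ℝ g g
  skew : ∀ (Z : h) (x y : g), form (act Z x) y = -form x (act Z y)

variable {g h : Type*} [LieRing g] [LieAlgebra ℝ g] [LieRing h] [LieAlgebra ℝ h]

/-- The double extension of `g` by `h`, with underlying vector space `g ⊕ h ⊕ h*`. -/
def DoubleExtension (_ : DoubleExtensionData g h) : Type _ := g × h × Module.Dual ℝ h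

namespace DoubleExtension

variable (D : DoubleExtensionData g h)

instance : AddCommGroup (DoubleExtension D) :=
  inferInstanceAs (AddCommGroup (g × h × Module.Dual ℝ h))

instance : Module ℝ (DoubleExtension D) :=
  inferInstanceAs (Module ℝ (g × h × Module.Dual ℝ h))

/-- The `h*`-valued cocycle on `g`: `(x, y) ↦ (Z ↦ ⟨Z · x, y⟩)`. -/
def cocycle (x y : g) : Module.Dual ℝ h where
  toFun Z := D.form (D.act Z x) y
  map_add' Z W := by simp
  map_smul' r Z := by simp

/-- In terms of generators: `[G, G'] = [G, G']_g + Σ_α ⟨H_α · G, G'⟩ H^{*α}`, `[H, G] = H · G`,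
`[H, H'] = [H, H']_h`, `[H, H*] = ad*_H H*`, `[H*, G] = [H*, H*'] = 0`. -/
instance : Bracket (DoubleExtension D) (DoubleExtension D) :=
  ⟨fun p q => (⁅p.1, q.1⁆ + D.act p.2.1 q.1 - D.act q.2.1 p.1, ⁅p.2.1, q.2.1⁆,
    ⁅p.2.1, q.2.2⁆ - ⁅q.2.1, p.2.2⁆ + cocycle D p.1 q.1)⟩

theorem bracket_def (p q : DoubleExtension D) :
    ⁅p, q⁆ = ((⁅p.1, q.1⁆ + D.act p.2.1 q.1 - D.act q.2.1 p.1, ⁅p.2.1, q.2.1⁆,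
      ⁅p.2.1, q.2.2⁆ - ⁅q.2.1, p.2.2⁆ + cocycle D p.1 q.1) : g × h × Module.Dual ℝ h) := rfl

theorem ext_iff' {p q : DoubleExtension D} :
    p = q ↔ p.1 = q.1 ∧ p.2.1 = q.2.1 ∧ ∀ Z, p.2.2 Z = q.2.2 Z := by
  constructor
  · rintro rfl
    exact ⟨rfl, rfl, fun _ => rfl⟩
  · rintro ⟨h1, h2, h3⟩
    exact Prod.ext h1 (Prod.ext h2 (LinearMap.ext h3))

theorem add_fst (p q : DoubleExtension D) : (p + q).1 = p.1 + q.1 := rfl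
theorem add_snd (p q : DoubleExtension D) : (p + q).2.1 = p.2.1 + q.2.1 := rfl
theorem add_thd (p q : DoubleExtension D) (Z : h) : (p + q).2.2 Z = p.2.2 Z + q.2.2 Z := rfl
theorem smul_fst (r : ℝ) (p : DoubleExtension D) : (r • p).1 = r • p.1 := rfl
theorem smul_snd (r : ℝ) (p : DoubleExtension D) : (r • p).2.1 = r • p.2.1 := rfl
theorem smul_thd (r : ℝ) (p : DoubleExtension D) (Z : h) : (r • p).2.2 Z = r * p.2.2 Z := rfl
theorem zero_fst : (0 : DoubleExtension D).1 = 0 := rfl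
theorem zero_snd : (0 : DoubleExtension D).2.1 = 0 := rfl
theorem zero_thd (Z : h) : (0 : DoubleExtension D).2.2 Z = 0 := rfl
theorem bracket_fst (p q : DoubleExtension D) :
    ⁅p, q⁆.1 = ⁅p.1, q.1⁆ + D.act p.2.1 q.1 - D.act q.2.1 p.1 := rfl
theorem bracket_snd (p q : DoubleExtension D) : ⁅p, q⁆.2.1 = ⁅p.2.1, q.2.1⁆ := rfl
theorem bracket_thd (p q : DoubleExtension D) (Z : h) :
    ⁅p, q⁆.2.2 Z = -q.2.2 ⁅p.2.1, Z⁆ + p.2.2 ⁅q.2.1, Z⁆ + D.form (D.act Z p.1) q.1 := by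
  change -q.2.2 ⁅p.2.1, Z⁆ - -p.2.2 ⁅q.2.1, Z⁆ + D.form (D.act Z p.1) q.1 = _
  rw [sub_neg_eq_add]

theorem form_act_self (Z : h) (x : g) : D.form (D.act Z x) x = 0 := by
  have h1 := D.skew Z x x
  rw [D.isMetric.1.1.eq x] at h1
  linarith

instance : LieRing (DoubleExtension D) where
  add_lie p q r := by
    rw [ext_iff']
    refine ⟨?_, ?_, fun Z => ?_⟩
    · simp only [bracket_fst, add_fst, add_snd, add_lie, map_add, LieDerivation.add_apply]
      abel
    · simp only [bracket_snd, add_snd, add_lie]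
    · simp only [bracket_thd, add_thd, add_fst, add_snd, add_lie, map_add, LinearMap.add_apply]
      ring
  lie_add p q r := by
    rw [ext_iff']
    refine ⟨?_, ?_, fun Z => ?_⟩
    · simp only [bracket_fst, add_fst, add_snd, lie_add, map_add, LieDerivation.add_apply]
      abel
    · simp only [bracket_snd, add_snd, lie_add]
    · simp only [bracket_thd, add_thd, add_fst, add_snd, add_lie, map_add]
      ring
  lie_self p := by
    rw [ext_iff']
    refine ⟨?_, ?_, fun Z => ?_⟩
    · rw [bracket_fst, lie_self, zero_fst]
      abel
    · rw [bracket_snd, lie_self, zero_snd]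
    · rw [bracket_thd, form_act_self, zero_thd]
      ring
  leibniz_lie p q r := by
    rw [ext_iff']
    refine ⟨?_, ?_, fun Z => ?_⟩
    · simp only [bracket_fst, bracket_snd, add_fst, lie_add, lie_sub, add_lie, sub_lie, map_add,
        map_sub, LieHom.map_lie, LieDerivation.lie_apply, LieDerivation.apply_lie_eq_add]
      rw [leibniz_lie p.1 q.1 r.1]
      simp only [← lie_skew _ (D.act _ _)]
      abel
    · simp only [bracket_snd, add_snd]
      exact leibniz_lie _ _ _
    · have hinv : ∀ x y z : g, D.form ⁅x, y⁆ z = -D.form y ⁅x, z⁆ := D.isMetric.1.2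
      have hsym : ∀ x y : g, D.form x y = D.form y x := D.isMetric.1.1.eq
      have hs : ∀ (W Z : h) (x y : g), D.form (D.act Z x) (D.act W y) =
          -D.form (D.act W (D.act Z x)) y := fun W Z x y => by rw [D.skew W, neg_neg]
      have e1 : D.form (D.act Z q.1) (D.act r.2.1 p.1) =
          -D.form (D.act Z (D.act r.2.1 p.1)) q.1 := by rw [hsym, D.skew Z, neg_neg]
      have e2 : D.form ⁅D.act Z p.1, q.1⁆ r.1 = D.form (D.act Z p.1) ⁅q.1, r.1⁆ := by
        rw [← lie_skew, map_neg, LinearMap.neg_apply, hinv, neg_neg]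
      have e3 : D.form ⁅p.1, D.act Z q.1⁆ r.1 = -D.form (D.act Z q.1) ⁅p.1, r.1⁆ := hinv _ _ _
      simp only [bracket_fst, bracket_snd, bracket_thd, add_thd, map_add, map_sub, LieHom.map_lie,
        LieDerivation.lie_apply, LieDerivation.apply_lie_eq_add, LinearMap.add_apply,
        LinearMap.sub_apply, lie_lie, hs, e2, e3]
      rw [hs] at e1
      linarith

instance : LieAlgebra ℝ (DoubleExtension D) where
  lie_smul r p q := by
    rw [ext_iff']
    refine ⟨?_, ?_, fun Z => ?_⟩
    · simp only [bracket_fst, smul_fst, smul_snd, lie_smul, map_smul, LieDerivation.smul_apply,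
        smul_add, smul_sub]
    · simp only [bracket_snd, smul_snd, lie_smul]
    · simp only [bracket_thd, smul_thd, smul_fst, smul_snd, smul_lie, map_smul, smul_eq_mul]
      ring

/-- The ideal `h*` spanned by the added generators. -/
def added : Submodule ℝ (DoubleExtension D) where
  carrier := {p | p.1 = 0 ∧ p.2.1 = 0}
  add_mem' {p q} hp hq := ⟨by rw [add_fst, hp.1, hq.1, add_zero],
    by rw [add_snd, hp.2, hq.2, add_zero]⟩
  zero_mem' := ⟨rfl, rfl⟩
  smul_mem' r p hp := ⟨by rw [smul_fst, hp.1, smul_zero], by rw [smul_snd, hp.2, smul_zero]⟩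

end DoubleExtension

/-- A Chern–Simons theory with gauge algebra `e` for the Klein pair `(k, b)`. The gauge algebra
carries an invariant metric (the trace that enters the action) and is an extension of `k`: it comes
with a surjection `e → k`, whose kernel consists of the added generators. The isotropy subalgebra
of `e` is the full preimage of `b`, so that after division by the kernel, which acts trivially on
the spacetime, one recovers the Klein pair `(k, b)`. -/
structure ChernSimonsTheory {k : Type*} [LieRing k] [LieAlgebra ℝ k] (b : LieSubalgebra ℝ k)
    (e : Type*) [LieRing e] [LieAlgebra ℝ e] where
  finite : FiniteDimensional ℝ e
  form : LinearMap.BilinForm ℝ e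
  isMetric : IsInvariantMetric form
  proj : e →ₗ⁅ℝ⁆ k
  surjective : Function.Surjective proj
  isotropy : LieSubalgebra ℝ e
  isotropy_eq : isotropy = b.comap proj

variable {k : Type*} [LieRing k] [LieAlgebra ℝ k]

/-- The number of generators that the gauge algebra has in addition to those of `k`. -/
noncomputable def ChernSimonsTheory.numAdded {b : LieSubalgebra ℝ k} {e : Type*} [LieRing e]
    [LieAlgebra ℝ e] (S : ChernSimonsTheory b e) : ℕ :=
  Module.finrank ℝ S.proj.ker

/-- The extension is central. -/
def ChernSimonsTheory.IsCentral {b : LieSubalgebra ℝ k} {e : Type*} [LieRing e]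
    [LieAlgebra ℝ e] (S : ChernSimonsTheory b e) : Prop :=
  S.proj.ker ≤ LieAlgebra.center ℝ e

/-- There is a Chern–Simons theory for `(k, b)` whose gauge algebra is a central extension of `k`
by `n` generators. -/
def HasCentralTheory (b : LieSubalgebra ℝ k) (n : ℕ) : Prop :=
  ∃ (e : Type) (_ : LieRing e) (_ : LieAlgebra ℝ e) (S : ChernSimonsTheory b e),
    S.IsCentral ∧ S.numAdded = n

/-- There is a Chern–Simons theory for `(k, b)` whose gauge algebra is a double extension
`D(g, h)`, where the `n` added generators are those of `h*`; equivalently, `k` is the semidirect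
sum of the ideal `g` and the subalgebra `h`. -/
def HasDoubleExtensionTheory (b : LieSubalgebra ℝ k) (n : ℕ) : Prop :=
  ∃ (g h : Type) (_ : LieRing g) (_ : LieAlgebra ℝ g) (_ : LieRing h) (_ : LieAlgebra ℝ h)
    (D : DoubleExtensionData g h) (S : ChernSimonsTheory b (DoubleExtension D)),
    S.proj.ker.toSubmodule = DoubleExtension.added D ∧ S.numAdded = n

/-- As `HasDoubleExtensionTheory`, where moreover the added generators are central. -/
def HasCentralDoubleExtensionTheory (b : LieSubalgebra ℝ k) (n : ℕ) : Prop :=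
  ∃ (g h : Type) (_ : LieRing g) (_ : LieAlgebra ℝ g) (_ : LieRing h) (_ : LieAlgebra ℝ h)
    (D : DoubleExtensionData g h) (S : ChernSimonsTheory b (DoubleExtension D)),
    S.proj.ker.toSubmodule = DoubleExtension.added D ∧ S.IsCentral ∧ S.numAdded = n

/-- There is a Chern–Simons theory for `(k, b)` whose gauge algebra is the coadjoint extension
`D(0, k) = k ⊕ k*` of `k`. -/
def HasCoadjointTheory (b : LieSubalgebra ℝ k) : Prop :=
  ∃ (z : Type) (_ : LieRing z) (_ : LieAlgebra ℝ z) (_ : Subsingleton z)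
    (D : DoubleExtensionData z k) (S : ChernSimonsTheory b (DoubleExtension D)),
    ∀ p, S.proj p = p.2.1

/-- `n` is the smallest number of added generators among all Chern–Simons theories for `(k, b)`,
whatever the kind of the extension. -/
def IsMinimalAdded (b : LieSubalgebra ℝ k) (n : ℕ) : Prop :=
  IsLeast {m | ∃ (e : Type) (_ : LieRing e) (_ : LieAlgebra ℝ e) (S : ChernSimonsTheory b e),
    S.numAdded = m} n

/-- The Lie algebra `k` carries an invariant metric. -/
def HasInvariantMetric (k : Type*) [LieRing k] [LieAlgebra ℝ k] : Prop :=
  ∃ B : LinearMap.BilinForm ℝ k, IsInvariantMetric B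

end General

/-- The invariant symmetric bilinear forms on the Lie algebra of `T` are exactly those with matrix
`M p` for some value `p` of the parameters, and such a form is nondegenerate precisely when the
condition `nd p` holds. -/
def GeneralInvariantForm {ι : Type} [Fintype ι] [DecidableEq ι] (T : KleinTable ι) {Par : Type}
    (M : Par → ι → ι → ℝ) (nd : Par → Prop) : Prop :=
  (∀ B : LinearMap.BilinForm ℝ T.Alg, IsInvariantForm B ↔ ∃ p, B = T.form (M p)) ∧
    ∀ p, (T.form (M p)).Nondegenerate ↔ nd p

/-! The lower bounds come from one observation about an arbitrary Chern–Simons theory `e → k` with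
kernel `K`. The orthogonal complement of `K` is an ideal of `e`, and its image `I` in `k` is an
ideal of codimension at most `dim K`. Since the double complement of `K` is `K` itself, the metric
of `e` descends to a nondegenerate form on `I`, invariant under all of `k`, not only under `I`. If
`K` is central, `I` moreover contains all brackets of `k`. Hence `N` is at least the least
codimension of an ideal of `k` with a `k`-invariant metric, and there is no central theory if no
such ideal contains all brackets (`finrank_le_of_forall_isInvariantMetricOn`,
`not_hasCentralTheory`).

Conversely, if `I` has such a metric and `h` is a complementary subalgebra, then `D(I, h)` projects
onto `k`, the sum of `I` and `h`, with kernel `h*`, so it adds exactly the codimension of `I`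
(`hasDoubleExtensionTheory_of_ideal`). It is central if `h` is abelian. The case `I = k` is an
invariant metric on `k`, the case `I = 0` the coadjoint extension.

It remains to find these ideals where `k` has no invariant metric. There `k` is an abelian ideal `V`
plus commuting elements `J`, `H`, with `J² = -1` on `V`. A combination of `J` and `H` that lies in
`I` must act trivially on `V` (`IsRotationSplit.torus_lie_eq_zero`); so `I` lies in `V` once `J`,
`H` act independently. In the torsional galilean cases `H` satisfies on `V` its characteristic
equation over the complex numbers generated by `J`. As `H` and `J` are skew on `I` while `H²` and
`JH` are symmetric, the skew part `βH + α'J` of this equation vanishes on `I`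
(`IsRotationSplit.linear_relation`). So `H` would be a real multiple of `J` there, which is possible
for a nonzero `I` only if `γ = 0`; then the eigenspace in question carries an invariant metric and
has a complementary subalgebra.

The invariant forms themselves are found by linear algebra: invariance under `J` expresses all
entries that involve a boost or a translation through `⟨J, J⟩` and `⟨J, H⟩` (`entry_eq`). -/

section InvariantMetricOnIdeal

variable {k : Type*} [LieRing k] [LieAlgebra ℝ k]

/-- The bilinear form `F` on `k` restricts to a nondegenerate symmetric form on the ideal `I` which
is invariant under the adjoint action of all of `k`. -/
structure IsInvariantMetricOn (I : LieIdeal ℝ k) (F : LinearMap.BilinForm ℝ k) : Prop where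
  symm : ∀ x ∈ I, ∀ y ∈ I, F x y = F y x
  inv : ∀ z : k, ∀ x ∈ I, ∀ y ∈ I, F ⁅z, x⁆ y = -F x ⁅z, y⁆
  nondeg : ∀ x ∈ I, (∀ y ∈ I, F x y = 0) → x = 0

theorem nondegenerate_of_symm {V : Type*} [AddCommGroup V] [Module ℝ V]
    {B : LinearMap.BilinForm ℝ V} (hs : ∀ x y, B x y = B y x)
    (h : ∀ x, (∀ y, B x y = 0) → x = 0) : B.Nondegenerate :=
  ⟨h, fun y hy => h y fun x => (hs y x).trans (hy x)⟩

/-! ### The ideal of `k` attached to a theory, and the lower bounds -/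

namespace ChernSimonsTheory

variable {b : LieSubalgebra ℝ k} {e : Type*} [LieRing e] [LieAlgebra ℝ e]
  (S : ChernSimonsTheory b e)

/-- The image in `k` of the orthogonal complement of the added generators. -/
def coreIdeal : LieIdeal ℝ k where
  toSubmodule := (S.form.orthogonal S.proj.ker.toSubmodule).map (S.proj : e →ₗ[ℝ] k)
  lie_mem {x m} hm := by
    obtain ⟨u, hu, rfl⟩ := hm
    obtain ⟨z, rfl⟩ := S.surjective x
    refine ⟨⁅z, u⁆, fun n hn => ?_, LieHom.map_lie _ _ _⟩
    have h1 : S.form ⁅z, n⁆ u = -S.form n ⁅z, u⁆ := S.isMetric.1.2 z n u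
    have h2 : S.form ⁅z, n⁆ u = 0 := hu _ (S.proj.ker.lie_mem hn)
    change S.form n ⁅z, u⁆ = 0
    linarith

/-- The complement of the kernel meets the kernel in the radical of the restricted form, so the
metric of `e` passes to the quotient, which is the ideal. The quotient form is written with a linear
section of the projection. -/
theorem exists_isInvariantMetricOn_coreIdeal :
    ∃ F, IsInvariantMetricOn S.coreIdeal F := by
  have hsym : ∀ x y, S.form x y = S.form y x := S.isMetric.1.1.eq
  have hinv : ∀ z x y, S.form ⁅z, x⁆ y = -S.form x ⁅z, y⁆ := S.isMetric.1.2
  let p : S.form.orthogonal S.proj.ker.toSubmodule →ₗ[ℝ] S.coreIdeal :=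
    ((S.proj : e →ₗ[ℝ] k).comp (Submodule.subtype _)).codRestrict S.coreIdeal.toSubmodule
      fun u => ⟨u, u.2, rfl⟩
  have hp : Function.Surjective p := by
    rintro ⟨_, u, hu, rfl⟩
    exact ⟨⟨u, hu⟩, rfl⟩
  obtain ⟨s, hs⟩ := p.exists_rightInverse_of_surjective (LinearMap.range_eq_top.2 hp)
  -- The form has to be defined on all of `k`, so the section is extended linearly; its values off
  -- the ideal are irrelevant.
  obtain ⟨r, hr⟩ := LinearMap.exists_extend ((Submodule.subtype _).comp s)
  have hr1 : ∀ x ∈ S.coreIdeal, ∀ n, S.proj n = 0 → S.form n (r x) = 0 := fun x hx n hn => by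
    have h : r x = s ⟨x, hx⟩ := LinearMap.congr_fun hr ⟨x, hx⟩
    rw [h]
    exact (s ⟨x, hx⟩).2 n hn
  have hr2 : ∀ x ∈ S.coreIdeal, S.proj (r x) = x := fun x hx => by
    have h : r x = s ⟨x, hx⟩ := LinearMap.congr_fun hr ⟨x, hx⟩
    rw [h]
    exact congrArg Subtype.val (LinearMap.congr_fun hs ⟨x, hx⟩)
  -- Independence of the lift: two lifts of `x` differ by an element of the kernel, to which `r y`
  -- is orthogonal.
  have key : ∀ u x, S.proj u = x → x ∈ S.coreIdeal → ∀ y ∈ S.coreIdeal,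
      S.form u (r y) = S.form (r x) (r y) := fun u x hu hx y hy => by
    rw [← sub_eq_zero, ← LinearMap.sub_apply, ← map_sub]
    exact hr1 y hy _ (by rw [map_sub, hu, hr2 x hx, sub_self])
  refine ⟨S.form.compl₁₂ r r, fun x _ y _ => hsym _ _, fun z x hx y hy => ?_,
    fun x hx h => ?_⟩
  · obtain ⟨w, rfl⟩ := S.surjective z
    have hx' : ⁅S.proj w, x⁆ ∈ S.coreIdeal := S.coreIdeal.lie_mem hx
    have hy' : ⁅S.proj w, y⁆ ∈ S.coreIdeal := S.coreIdeal.lie_mem hy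
    have e1 : S.form (r ⁅S.proj w, x⁆) (r y) = S.form ⁅w, r x⁆ (r y) :=
      (key _ _ (by rw [LieHom.map_lie, hr2 x hx]) hx' y hy).symm
    have e2 : S.form (r x) (r ⁅S.proj w, y⁆) = S.form (r x) ⁅w, r y⁆ := by
      rw [hsym, hsym _ ⁅w, r y⁆]
      exact (key _ _ (by rw [LieHom.map_lie, hr2 y hy]) hy' x hx).symm
    change S.form (r ⁅S.proj w, x⁆) (r y) = -S.form (r x) (r ⁅S.proj w, y⁆)
    rw [e1, e2, hinv]
  -- A vector orthogonal to the whole ideal lifts into the double complement of the kernel, which is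
  -- the kernel, so it vanishes in `k`.
  · have hfin := S.finite
    have h1 : r x ∈ S.form.orthogonal (S.form.orthogonal S.proj.ker.toSubmodule) := by
      intro n hn
      have hpn : S.proj n ∈ S.coreIdeal := ⟨n, hn, rfl⟩
      have h2 := h _ hpn
      change S.form n (r x) = 0
      rw [key n _ rfl hpn x hx, hsym]
      exact h2
    rw [LinearMap.BilinForm.orthogonal_orthogonal S.isMetric.2 S.isMetric.1.1.isRefl] at h1
    rw [← hr2 x hx]
    exact h1

/-- The complement of the kernel `K` has dimension `dim e - dim K = dim k`, and projecting it to `k`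
loses only its intersection with `K`. -/
theorem finrank_le_finrank_coreIdeal_add_numAdded :
    Module.finrank ℝ k ≤ Module.finrank ℝ S.coreIdeal + S.numAdded := by
  have hfin := S.finite
  have h1 := LinearMap.BilinForm.finrank_orthogonal S.isMetric.2 S.proj.ker.toSubmodule
  have h2 := ((S.proj : e →ₗ[ℝ] k).domRestrict
    (S.form.orthogonal S.proj.ker.toSubmodule)).finrank_range_add_finrank_ker
  have h3 := (S.proj : e →ₗ[ℝ] k).finrank_range_add_finrank_ker
  rw [LinearMap.range_eq_top.2 S.surjective, finrank_top] at h3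
  have h4 : LinearMap.range ((S.proj : e →ₗ[ℝ] k).domRestrict
      (S.form.orthogonal S.proj.ker.toSubmodule)) = S.coreIdeal.toSubmodule := by
    rw [LinearMap.range_domRestrict]
    rfl
  rw [h4] at h2
  have h5 : Module.finrank ℝ (LinearMap.ker ((S.proj : e →ₗ[ℝ] k).domRestrict
      (S.form.orthogonal S.proj.ker.toSubmodule))) ≤
      Module.finrank ℝ (LinearMap.ker (S.proj : e →ₗ[ℝ] k)) := by
    refine LinearMap.finrank_le_finrank_of_injective
      (f := ((Submodule.subtype _).comp (Submodule.subtype _)).codRestrict _ fun u => ?_) ?_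
    · exact u.2
    · intro u v huv
      have huv' := congrArg Subtype.val huv
      exact Subtype.ext (Subtype.ext huv')
  have h6 : S.numAdded = Module.finrank ℝ (LinearMap.ker (S.proj : e →ₗ[ℝ] k)) := rfl
  have h7 : Module.finrank ℝ S.proj.ker.toSubmodule = S.numAdded := rfl
  have h8 : Module.finrank ℝ S.coreIdeal = Module.finrank ℝ S.coreIdeal.toSubmodule := rfl
  omega

/-- By invariance, brackets in `e` are orthogonal to the centre, hence to a central kernel. -/
theorem lie_mem_coreIdeal_of_isCentral (hS : S.IsCentral) (x y : k) : ⁅x, y⁆ ∈ S.coreIdeal := by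
  obtain ⟨u, rfl⟩ := S.surjective x
  obtain ⟨v, rfl⟩ := S.surjective y
  refine ⟨⁅u, v⁆, fun n hn => ?_, LieHom.map_lie _ _ _⟩
  have hc : ⁅u, n⁆ = 0 := hS hn u
  have h1 : S.form ⁅u, n⁆ v = -S.form n ⁅u, v⁆ := S.isMetric.1.2 u n v
  rw [hc, map_zero, LinearMap.zero_apply] at h1
  change S.form n ⁅u, v⁆ = 0
  linarith

end ChernSimonsTheory

theorem finrank_le_of_forall_isInvariantMetricOn {d : ℕ} {b : LieSubalgebra ℝ k}
    (h : ∀ (I : LieIdeal ℝ k) F, IsInvariantMetricOn I F → Module.finrank ℝ I ≤ d)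
    {e : Type*} [LieRing e] [LieAlgebra ℝ e] (S : ChernSimonsTheory b e) :
    Module.finrank ℝ k ≤ d + S.numAdded := by
  obtain ⟨F, hF⟩ := S.exists_isInvariantMetricOn_coreIdeal
  have := h _ F hF
  have := S.finrank_le_finrank_coreIdeal_add_numAdded
  omega

theorem not_hasCentralTheory {b : LieSubalgebra ℝ k}
    (h : ∀ (I : LieIdeal ℝ k) F, IsInvariantMetricOn I F → ∃ x y : k, ⁅x, y⁆ ∉ I) (n : ℕ) :
    ¬HasCentralTheory b n := by
  rintro ⟨e, _, _, S, hS, -⟩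
  obtain ⟨F, hF⟩ := S.exists_isInvariantMetricOn_coreIdeal
  obtain ⟨x, y, hxy⟩ := h _ F hF
  exact hxy (S.lie_mem_coreIdeal_of_isCentral hS x y)

/-- An algebra with an invariant metric is its own gauge algebra. -/
theorem HasInvariantMetric.isMinimalAdded {k : Type} [LieRing k] [LieAlgebra ℝ k]
    [FiniteDimensional ℝ k] (h : HasInvariantMetric k) (b : LieSubalgebra ℝ k) :
    IsMinimalAdded b 0 := by
  obtain ⟨B, hB⟩ := h
  refine ⟨⟨k, _, _, ⟨‹_›, B, hB, LieHom.id, Function.surjective_id, _, rfl⟩, ?_⟩,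
    fun _ _ => Nat.zero_le _⟩
  have : (LieHom.id : k →ₗ⁅ℝ⁆ k).ker = ⊥ := by
    rw [LieHom.ker_eq_bot]
    exact Function.injective_id
  change Module.finrank ℝ (LieHom.id : k →ₗ⁅ℝ⁆ k).ker = 0
  rw [this]
  exact finrank_bot ℝ k

end InvariantMetricOnIdeal

/-! ### Ideals with an invariant metric in a rotation split algebra -/

section SplitAlgebra

variable {k : Type*} [LieRing k] [LieAlgebra ℝ k]

/-- `k` is the semidirect sum of an abelian ideal `V` and the commuting elements `J`, `H`, where `J`
acts on `V` as a complex structure. -/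
structure IsRotationSplit (J H : k) (V : Submodule ℝ k) : Prop where
  comm : ⁅J, H⁆ = 0
  abelian : ∀ v ∈ V, ∀ w ∈ V, ⁅v, w⁆ = 0
  mem_J : ∀ v ∈ V, ⁅J, v⁆ ∈ V
  J_J : ∀ v ∈ V, ⁅J, ⁅J, v⁆⁆ = -v
  span : ∀ x, ∃ r s : ℝ, ∃ v ∈ V, x = (r • J + s • H) + v

namespace IsRotationSplit

variable {J H : k} {V : Submodule ℝ k} {I : LieIdeal ℝ k} {F : LinearMap.BilinForm ℝ k}

theorem lie_J_torus (hV : IsRotationSplit J H V)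
    (r s : ℝ) : ⁅J, r • J + s • H⁆ = 0 := by
  rw [lie_add, lie_smul, lie_smul, lie_self, hV.comm, smul_zero, smul_zero, add_zero]

/-- Applying `J` twice kills the torus part and reverses the sign of the part in `V`, so an ideal
contains the two components of each of its elements. -/
theorem mem_ideal_of_add_mem (hV : IsRotationSplit J H V)
    {r s : ℝ} {v : k} (hv : v ∈ V) (h : (r • J + s • H) + v ∈ I) :
    v ∈ I ∧ r • J + s • H ∈ I := by
  have h1 : ⁅J, ⁅J, (r • J + s • H) + v⁆⁆ = -v := by
    rw [lie_add, hV.lie_J_torus, zero_add, hV.J_J v hv]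
  have h2 : v ∈ I := by
    rw [← neg_neg v, ← h1]
    exact I.neg_mem (I.lie_mem (I.lie_mem h))
  refine ⟨h2, ?_⟩
  have := I.sub_mem h h2
  rwa [add_sub_cancel_right] at this

/-- For `Z` in the ideal and in the span of `J` and `H`, the bracket `[Z, v]` is orthogonal to the
whole ideal. Against its part in `V`, move `v` to the other side and use that `V` is abelian.
Against its torus part, write `[Z, v] = -[J, [J, [Z, v]]]` and move the outer `J` across; it
commutes with the torus. -/
theorem torus_lie_eq_zero (hV : IsRotationSplit J H V) (hF : IsInvariantMetricOn I F)
    {r s : ℝ} (h : r • J + s • H ∈ I) (h' : ∀ v ∈ V, ⁅H, v⁆ ∈ V)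
    {v : k} (hv : v ∈ V) : ⁅r • J + s • H, v⁆ = 0 := by
  have hmem : ⁅r • J + s • H, v⁆ ∈ I := lie_mem_left ℝ k I _ _ h
  have hmemV : ⁅r • J + s • H, v⁆ ∈ V := by
    rw [add_lie, smul_lie, smul_lie]
    exact V.add_mem (V.smul_mem _ (hV.mem_J v hv)) (V.smul_mem _ (h' v hv))
  refine hF.nondeg _ hmem fun y hy => ?_
  obtain ⟨r', s', u, hu, rfl⟩ := hV.span y
  obtain ⟨hu', hZ'⟩ := hV.mem_ideal_of_add_mem hu hy
  have e1 : F ⁅r • J + s • H, v⁆ u = 0 := by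
    rw [← lie_skew, map_neg, LinearMap.neg_apply, hF.inv v _ h _ hu', hV.abelian v hv u hu,
      map_zero, neg_zero, neg_zero]
  have e2 : F ⁅r • J + s • H, v⁆ (r' • J + s' • H) = 0 := by
    rw [← neg_neg ⁅r • J + s • H, v⁆, ← hV.J_J _ hmemV, map_neg, LinearMap.neg_apply,
      hF.inv J _ (I.lie_mem hmem) _ hZ', hV.lie_J_torus, map_zero, neg_zero, neg_zero]
  rw [map_add, e1, e2, add_zero]

theorem ideal_le (hV : IsRotationSplit J H V) (hF : IsInvariantMetricOn I F)
    (h' : ∀ v ∈ V, ⁅H, v⁆ ∈ V)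
    (hne : ∀ r s : ℝ, (∀ v ∈ V, ⁅r • J + s • H, v⁆ = 0) → r = 0 ∧ s = 0)
    {x : k} (hx : x ∈ I) : x ∈ V := by
  obtain ⟨r, s, v, hv, rfl⟩ := hV.span x
  obtain ⟨rfl, rfl⟩ := hne r s fun w hw =>
    hV.torus_lie_eq_zero hF (hV.mem_ideal_of_add_mem hv hx).2 h' hw
  simpa using hv

/-- A quadratic relation for the action of `H` on `V`, together with the adjoint relation, yields a
linear one on an ideal in `V` which has an invariant metric. -/
theorem linear_relation (hV : IsRotationSplit J H V) (hF : IsInvariantMetricOn I F)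
    (hI : ∀ x ∈ I, x ∈ V) {α β β' α' : ℝ}
    (hrel : ∀ v ∈ V, ⁅H, ⁅H, v⁆⁆ = β • ⁅H, v⁆ + β' • ⁅J, ⁅H, v⁆⁆ - α • v + α' • ⁅J, v⁆)
    {x : k} (hx : x ∈ I) : β • ⁅H, x⁆ + α' • ⁅J, x⁆ = 0 := by
  have hH : ∀ {u}, u ∈ I → ⁅H, u⁆ ∈ I := fun hu => I.lie_mem hu
  have hJ : ∀ {u}, u ∈ I → ⁅J, u⁆ ∈ I := fun hu => I.lie_mem hu
  refine hF.nondeg _ (I.add_mem (I.smul_mem _ (hH hx)) (I.smul_mem _ (hJ hx))) fun y hy => ?_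
  have e1 := congrArg (fun u => F u y) (hrel x (hI x hx))
  have e2 := congrArg (F x) (hrel y (hI y hy))
  have comm : ⁅J, ⁅H, y⁆⁆ = ⁅H, ⁅J, y⁆⁆ := by
    rw [leibniz_lie J H y, hV.comm, zero_lie, zero_add]
  -- Products of two commuting skew maps are symmetric, so subtracting the relation for `y` from
  -- that for `x` leaves twice the skew terms.
  have i1 : F ⁅H, ⁅H, x⁆⁆ y = F x ⁅H, ⁅H, y⁆⁆ := by
    rw [hF.inv H _ (hH hx) _ hy, hF.inv H _ hx _ (hH hy), neg_neg]
  have i2 : F ⁅J, ⁅H, x⁆⁆ y = F x ⁅J, ⁅H, y⁆⁆ := by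
    rw [comm, hF.inv J _ (hH hx) _ hy, hF.inv H _ hx _ (hJ hy), neg_neg]
  have i3 := hF.inv H x hx y hy
  have i4 := hF.inv J x hx y hy
  simp only [map_add, map_sub, map_smul, LinearMap.add_apply, LinearMap.sub_apply,
    LinearMap.smul_apply, smul_eq_mul] at e1 e2 ⊢
  rw [i1, i2, i3, i4] at e1
  rw [i3, i4]
  linarith

end IsRotationSplit

end SplitAlgebra

/-! ### The metric of a double extension and its projection to `k` -/

namespace DoubleExtension

variable {g h : Type*} [LieRing g] [LieAlgebra ℝ g] [LieRing h] [LieAlgebra ℝ h]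
  (D : DoubleExtensionData g h)

/-- The form on `D(g, h)` that extends the metric of `g` by the pairing of `h` with `h*`. -/
def pairing : LinearMap.BilinForm ℝ (DoubleExtension D) :=
  LinearMap.mk₂ ℝ (fun p q => D.form p.1 q.1 + p.2.2 q.2.1 + q.2.2 p.2.1)
    (fun p p' q => by
      simp only [add_fst, add_snd, add_thd, map_add, LinearMap.add_apply]
      ring)
    (fun r p q => by
      simp only [smul_fst, smul_snd, smul_thd, map_smul, LinearMap.smul_apply, smul_eq_mul]
      ring)
    (fun p q q' => by
      simp only [add_fst, add_snd, add_thd, map_add]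
      ring)
    (fun r p q => by
      simp only [smul_fst, smul_snd, smul_thd, map_smul, smul_eq_mul]
      ring)

theorem pairing_apply (p q : DoubleExtension D) :
    pairing D p q = D.form p.1 q.1 + p.2.2 q.2.1 + q.2.2 p.2.1 := rfl

/-- The `h*`-component of the bracket on `g` is exactly what invariance requires once `h` acts by
skew maps and is paired with `h*`. -/
theorem isInvariantMetric_pairing : IsInvariantMetric (pairing D) := by
  have hsym : ∀ x y : g, D.form x y = D.form y x := D.isMetric.1.1.eq
  have hinv : ∀ x y z : g, D.form ⁅x, y⁆ z = -D.form y ⁅x, z⁆ := D.isMetric.1.2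
  have hs : ∀ p q, pairing D p q = pairing D q p := fun p q => by
    rw [pairing_apply, pairing_apply, hsym]
    ring
  refine ⟨⟨⟨hs⟩, fun p q r => ?_⟩, nondegenerate_of_symm hs fun p hp => ?_⟩
  · have e1 : D.form q.1 (D.act r.2.1 p.1) = D.form (D.act r.2.1 p.1) q.1 := hsym _ _
    have e2 := D.skew p.2.1 q.1 r.1
    have e3 := hinv p.1 q.1 r.1
    simp only [pairing_apply, bracket_fst, bracket_snd, bracket_thd, map_add, map_sub,
      LinearMap.add_apply, LinearMap.sub_apply]
    rw [e1, e2, e3, ← lie_skew p.2.1 q.2.1, ← lie_skew r.2.1 q.2.1, ← lie_skew p.2.1 r.2.1]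
    simp only [map_neg]
    ring
  · rw [ext_iff']
    -- Testing against `g`, `h*` and `h` annihilates the components in `g`, `h` and `h*`
    -- respectively.
    refine ⟨D.isMetric.2.1 _ fun y => ?_, ?_, fun Z => ?_⟩
    · have h1 : D.form p.1 y + p.2.2 0 + 0 = 0 := hp (y, 0, 0)
      rwa [map_zero, add_zero, add_zero] at h1
    · refine (Module.forall_dual_apply_eq_zero_iff ℝ p.2.1).1 fun f => ?_
      have h1 : D.form p.1 0 + p.2.2 0 + f p.2.1 = 0 := hp (0, 0, f)
      rwa [map_zero, map_zero, add_zero, zero_add] at h1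
    · have h1 : D.form p.1 0 + p.2.2 Z + 0 = 0 := hp (0, Z, 0)
      rwa [map_zero, zero_add, add_zero] at h1

theorem finrank_added : Module.finrank ℝ (added D) = Module.finrank ℝ h := by
  rw [← Subspace.dual_finrank_eq (K := ℝ) (V := h)]
  refine LinearEquiv.finrank_eq (LinearEquiv.ofBijective
    ({ toFun := fun p => p.1.2.2, map_add' := fun _ _ => rfl, map_smul' := fun _ _ => rfl } :
      added D →ₗ[ℝ] Module.Dual ℝ h) ⟨fun p q hpq => ?_, fun f => ?_⟩)
  · refine Subtype.ext (Prod.ext (p.2.1.trans q.2.1.symm) (Prod.ext (p.2.2.trans q.2.2.symm) hpq))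
  · exact ⟨⟨(0, 0, f), rfl, rfl⟩, rfl⟩

variable {k : Type*} [LieRing k] [LieAlgebra ℝ k]

/-- A decomposition of `k` into the image of `g` and the image of `h` turns `D(g, h)` into an
extension of `k`. -/
def toSum (i : g →ₗ⁅ℝ⁆ k) (j : h →ₗ⁅ℝ⁆ k) (hij : ∀ Z x, ⁅j Z, i x⁆ = i (D.act Z x)) :
    DoubleExtension D →ₗ⁅ℝ⁆ k where
  toFun p := i p.1 + j p.2.1
  map_add' p q := by
    rw [add_fst, add_snd, map_add, map_add]
    abel
  map_smul' r p := by
    rw [smul_fst, smul_snd, map_smul, map_smul, smul_add, RingHom.id_apply]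
  map_lie' {p q} := by
    change i ⁅p, q⁆.1 + j ⁅p, q⁆.2.1 = ⁅i p.1 + j p.2.1, i q.1 + j q.2.1⁆
    rw [bracket_fst, bracket_snd, map_sub, map_add, LieHom.map_lie, LieHom.map_lie, add_lie,
      lie_add, lie_add, hij, ← lie_skew (i p.1) (j q.2.1), hij]
    abel

end DoubleExtension

/-! ### Theories from an ideal with a metric and a complementary subalgebra -/

section Constructions

variable {k : Type} [LieRing k] [LieAlgebra ℝ k]

theorem HasCentralDoubleExtensionTheory.hasDoubleExtensionTheory {b : LieSubalgebra ℝ k} {n : ℕ}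
    (h : HasCentralDoubleExtensionTheory b n) : HasDoubleExtensionTheory b n := by
  obtain ⟨g, h, i1, i2, i3, i4, D, S, h1, -, h2⟩ := h
  exact ⟨g, h, i1, i2, i3, i4, D, S, h1, h2⟩

/-- A double extension theory is minimal if its number of added generators is the codimension
that every ideal with an invariant metric has at least. -/
theorem HasDoubleExtensionTheory.isMinimalAdded {b : LieSubalgebra ℝ k} {n d : ℕ}
    (h : HasDoubleExtensionTheory b n) (hk : Module.finrank ℝ k = d + n)
    (hd : ∀ (I : LieIdeal ℝ k) F, IsInvariantMetricOn I F → Module.finrank ℝ I ≤ d) :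
    IsMinimalAdded b n := by
  obtain ⟨g, h, i1, i2, i3, i4, D, S, -, hn⟩ := h
  refine ⟨⟨_, _, _, S, hn⟩, ?_⟩
  rintro m ⟨e, _, _, S', rfl⟩
  have := finrank_le_of_forall_isInvariantMetricOn hd S'
  omega

theorem HasCoadjointTheory.hasDoubleExtensionTheory {b : LieSubalgebra ℝ k}
    (h : HasCoadjointTheory b) : HasDoubleExtensionTheory b (Module.finrank ℝ k) := by
  obtain ⟨z, i1, i2, _, D, S, hS⟩ := h
  have hker : S.proj.ker.toSubmodule = DoubleExtension.added D := by
    ext p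
    refine ⟨fun hp => ⟨Subsingleton.elim _ _, (hS p).symm.trans hp⟩, fun hp => (hS p).trans hp.2⟩
  refine ⟨z, k, i1, i2, _, _, D, S, hker, ?_⟩
  change Module.finrank ℝ S.proj.ker.toSubmodule = _
  rw [hker, DoubleExtension.finrank_added]

variable [FiniteDimensional ℝ k]

/-- The data of a double extension given by an ideal with an invariant metric and a subalgebra. -/
def doubleExtensionDataOfIdeal {I : LieIdeal ℝ k} {F : LinearMap.BilinForm ℝ k}
    (hF : IsInvariantMetricOn I F) (h : LieSubalgebra ℝ k) : DoubleExtensionData I h where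
  form := F.compl₁₂ I.toSubmodule.subtype I.toSubmodule.subtype
  isMetric := by
    refine ⟨⟨⟨fun x y => hF.symm _ x.2 _ y.2⟩, fun z x y => hF.inv _ _ x.2 _ y.2⟩,
      nondegenerate_of_symm (fun x y => hF.symm _ x.2 _ y.2) fun x hx => ?_⟩
    exact Subtype.ext (hF.nondeg _ x.2 fun y hy => hx ⟨y, hy⟩)
  act :=
    { toFun := fun Z =>
        { toFun := fun x => ⁅(Z : k), x⁆
          map_add' := fun x y => lie_add _ _ _
          map_smul' := fun r x => lie_smul _ _ _
          leibniz' := fun x y => Subtype.ext (by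
            change ⁅(Z : k), ⁅(x : k), (y : k)⁆⁆ = ⁅(x : k), ⁅(Z : k), (y : k)⁆⁆ -
              ⁅(y : k), ⁅(Z : k), (x : k)⁆⁆
            rw [leibniz_lie (Z : k) (x : k) (y : k), ← lie_skew (y : k) ⁅(Z : k), (x : k)⁆]
            abel) }
      map_add' := fun Z W => LieDerivation.ext fun x => Subtype.ext (add_lie (Z : k) W (x : k))
      map_smul' := fun r Z => LieDerivation.ext fun x => Subtype.ext (smul_lie r (Z : k) (x : k))
      map_lie' := fun {Z W} => LieDerivation.ext fun x => Subtype.ext (lie_lie (Z : k) W (x : k)) }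
  skew Z x y := hF.inv _ _ x.2 _ y.2

/-- The double extension theory of an ideal with an invariant metric and a complementary
subalgebra. -/
noncomputable def theoryOfIdeal (b : LieSubalgebra ℝ k) {I : LieIdeal ℝ k}
    {F : LinearMap.BilinForm ℝ k} (hF : IsInvariantMetricOn I F) (h : LieSubalgebra ℝ k)
    (hsum : ∀ x, ∃ y ∈ I, ∃ z ∈ h, x = y + z) :
    ChernSimonsTheory b (DoubleExtension (doubleExtensionDataOfIdeal hF h)) where
  finite := inferInstanceAs (FiniteDimensional ℝ (I × h × Module.Dual ℝ h))
  form := DoubleExtension.pairing _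
  isMetric := DoubleExtension.isInvariantMetric_pairing _
  proj := DoubleExtension.toSum _ I.incl h.incl fun _ _ => rfl
  surjective x := by
    obtain ⟨y, hy, z, hz, rfl⟩ := hsum x
    exact ⟨(⟨y, hy⟩, ⟨z, hz⟩, 0), rfl⟩
  isotropy := _
  isotropy_eq := rfl

/-- If the components in `I` and `h` add up to zero, both lie in the trivial intersection of `I` and
`h`; only the component in `h*` is free. -/
theorem ker_theoryOfIdeal (b : LieSubalgebra ℝ k) {I : LieIdeal ℝ k}
    {F : LinearMap.BilinForm ℝ k} (hF : IsInvariantMetricOn I F) (h : LieSubalgebra ℝ k)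
    (hsum : ∀ x, ∃ y ∈ I, ∃ z ∈ h, x = y + z) (hdisj : ∀ x ∈ I, x ∈ h → x = 0) :
    (theoryOfIdeal b hF h hsum).proj.ker.toSubmodule = DoubleExtension.added _ := by
  ext p
  constructor
  · intro hp
    have hp' : (p.1 : k) + (p.2.1 : k) = 0 := hp
    have h1 : (p.1 : k) = 0 := by
      refine hdisj _ p.1.2 ?_
      rw [eq_neg_of_add_eq_zero_left hp']
      exact h.neg_mem p.2.1.2
    rw [h1, zero_add] at hp'
    exact ⟨Subtype.ext h1, Subtype.ext hp'⟩
  · rintro ⟨h1, h2⟩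
    change (p.1 : k) + (p.2.1 : k) = 0
    rw [h1, h2]
    exact add_zero 0

theorem numAdded_theoryOfIdeal (b : LieSubalgebra ℝ k) {I : LieIdeal ℝ k}
    {F : LinearMap.BilinForm ℝ k} (hF : IsInvariantMetricOn I F) (h : LieSubalgebra ℝ k)
    (hsum : ∀ x, ∃ y ∈ I, ∃ z ∈ h, x = y + z) (hdisj : ∀ x ∈ I, x ∈ h → x = 0) :
    (theoryOfIdeal b hF h hsum).numAdded = Module.finrank ℝ h := by
  change Module.finrank ℝ (theoryOfIdeal b hF h hsum).proj.ker.toSubmodule = _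
  rw [ker_theoryOfIdeal b hF h hsum hdisj, DoubleExtension.finrank_added]

theorem hasDoubleExtensionTheory_of_ideal (b : LieSubalgebra ℝ k) {I : LieIdeal ℝ k}
    {F : LinearMap.BilinForm ℝ k} (hF : IsInvariantMetricOn I F) (h : LieSubalgebra ℝ k)
    (hsum : ∀ x, ∃ y ∈ I, ∃ z ∈ h, x = y + z) (hdisj : ∀ x ∈ I, x ∈ h → x = 0) :
    HasDoubleExtensionTheory b (Module.finrank ℝ h) :=
  ⟨I, h, _, _, _, _, _, theoryOfIdeal b hF h hsum, ker_theoryOfIdeal b hF h hsum hdisj,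
    numAdded_theoryOfIdeal b hF h hsum hdisj⟩

/-- The only bracket involving `h*` is the coadjoint action of `h`, which is zero for abelian `h`.
-/
theorem hasCentralDoubleExtensionTheory_of_ideal (b : LieSubalgebra ℝ k) {I : LieIdeal ℝ k}
    {F : LinearMap.BilinForm ℝ k} (hF : IsInvariantMetricOn I F) (h : LieSubalgebra ℝ k)
    (hsum : ∀ x, ∃ y ∈ I, ∃ z ∈ h, x = y + z) (hdisj : ∀ x ∈ I, x ∈ h → x = 0)
    (hab : ∀ x ∈ h, ∀ y ∈ h, ⁅x, y⁆ = 0) :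
    HasCentralDoubleExtensionTheory b (Module.finrank ℝ h) := by
  refine ⟨I, h, _, _, _, _, _, theoryOfIdeal b hF h hsum, ker_theoryOfIdeal b hF h hsum hdisj,
    fun p hp q => ?_, numAdded_theoryOfIdeal b hF h hsum hdisj⟩
  obtain ⟨h1, h2⟩ : p ∈ DoubleExtension.added _ := by
    rw [← ker_theoryOfIdeal b hF h hsum hdisj]
    exact hp
  have hab' : ∀ x y : h, ⁅x, y⁆ = 0 := fun x y => Subtype.ext (hab x x.2 y y.2)
  rw [DoubleExtension.ext_iff']
  refine ⟨?_, ?_, fun Z => ?_⟩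
  · rw [DoubleExtension.bracket_fst, h1, h2, lie_zero, map_zero, map_zero, DoubleExtension.zero_fst]
    simp
  · rw [DoubleExtension.bracket_snd, h2, lie_zero, DoubleExtension.zero_snd]
  · rw [DoubleExtension.bracket_thd, h1, hab', hab', DoubleExtension.zero_thd]
    simp

theorem hasCoadjointTheory (b : LieSubalgebra ℝ k) : HasCoadjointTheory b := by
  let _ : LieRing PUnit.{1} := LieRing.ofAssociativeRing
  let _ : LieAlgebra ℝ PUnit.{1} := { lie_smul := fun _ _ _ => rfl }
  -- On the zero algebra the zero form is nondegenerate.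
  let D : DoubleExtensionData PUnit.{1} k :=
    { form := 0
      isMetric := ⟨⟨⟨fun _ _ => rfl⟩, fun _ _ _ => neg_zero.symm⟩,
        ⟨fun _ _ => Subsingleton.elim _ _, fun _ _ => Subsingleton.elim _ _⟩⟩
      act := 0
      skew := fun _ _ _ => neg_zero.symm }
  refine ⟨PUnit.{1}, _, _, inferInstance, D,
    { finite := inferInstanceAs (FiniteDimensional ℝ (PUnit.{1} × k × Module.Dual ℝ k))
      form := DoubleExtension.pairing D
      isMetric := DoubleExtension.isInvariantMetric_pairing D
      proj := DoubleExtension.toSum D 0 LieHom.id fun _ _ => lie_zero _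
      surjective := fun x => ⟨(0, x, 0), zero_add x⟩
      isotropy := _
      isotropy_eq := rfl }, fun p => zero_add p.2.1⟩

end Constructions

/-! ### Invariant forms in coordinates -/

namespace KleinTable

variable {ι : Type} [Fintype ι] (T : KleinTable ι)

theorem finrank_alg : Module.finrank ℝ T.Alg = Fintype.card ι :=
  Module.finrank_fintype_fun_eq_card ℝ

variable [DecidableEq ι]

theorem form_apply (M : ι → ι → ℝ) (x y : T.Alg) :
    T.form M x y = ∑ i, ∑ j, x i * M i j * y j := by
  exact Matrix.toBilin'_apply (Matrix.of M) x y

/-- The basis vectors of the Lie algebra of a table. -/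
def gen (i : ι) : T.Alg := Pi.single i (1 : ℝ)

theorem gen_apply (i j : ι) : T.gen i j = if j = i then 1 else 0 := Pi.single_apply i 1 j

theorem form_gen_right (M : ι → ι → ℝ) (x : T.Alg) (j : ι) :
    T.form M x (T.gen j) = ∑ i, x i * M i j := by
  simp [form_apply, gen_apply]

theorem form_gen_left (M : ι → ι → ℝ) (y : T.Alg) (i : ι) :
    T.form M (T.gen i) y = ∑ j, M i j * y j := by
  simp [form_apply, gen_apply]

theorem eq_form (B : LinearMap.BilinForm ℝ T.Alg) :
    B = T.form fun i j => B (T.gen i) (T.gen j) :=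
  (Matrix.toBilin'_toMatrix' (B : LinearMap.BilinForm ℝ (ι → ℝ))).symm

theorem bracket_gen (i j k : ι) : (⁅T.gen i, T.gen j⁆ : T.Alg) k = T.br i j k := by
  simp [bracket_apply, gen_apply]

/-- Reduction to matrices: necessity of the shape needs invariance on triples of generators only,
and degeneracy of a symmetric matrix is a nonzero vector in its kernel. -/
theorem generalInvariantForm {Par : Type} {M : Par → ι → ι → ℝ} {nd : Par → Prop}
    (hsymm : ∀ p i j, M p i j = M p j i)
    (hinv : ∀ p (z x y : T.Alg), T.form (M p) ⁅z, x⁆ y = -T.form (M p) x ⁅z, y⁆)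
    (hall : ∀ N : ι → ι → ℝ, (∀ i j, N i j = N j i) →
      (∀ i j k, ∑ m, T.br i j m * N m k = -∑ m, N j m * T.br i k m) → ∃ p, N = M p)
    (hnd : ∀ p, nd p → ∀ x : ι → ℝ, (∀ j, ∑ i, x i * M p i j = 0) → ∀ i, x i = 0)
    (hdeg : ∀ p, ¬nd p → ∃ x : ι → ℝ, (∃ i, x i ≠ 0) ∧ ∀ j, ∑ i, x i * M p i j = 0) :
    GeneralInvariantForm T M nd := by
  have hs : ∀ p (x y : T.Alg), T.form (M p) x y = T.form (M p) y x := fun p x y => by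
    rw [form_apply, form_apply, Finset.sum_comm]
    refine Finset.sum_congr rfl fun i _ => Finset.sum_congr rfl fun j _ => ?_
    rw [hsymm p j i]
    ring
  refine ⟨fun B => ⟨fun hB => ?_, ?_⟩, fun p => ⟨fun hp => ?_, fun hp => ?_⟩⟩
  · obtain ⟨p, hp⟩ := hall (fun i j => B (T.gen i) (T.gen j)) (fun i j => hB.1.eq _ _)
      fun i j k => by
        have h : B ⁅T.gen i, T.gen j⁆ (T.gen k) = -B (T.gen j) ⁅T.gen i, T.gen k⁆ := hB.2 _ _ _
        rw [T.eq_form B, form_gen_right, form_gen_left] at h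
        simpa only [bracket_gen] using h
    exact ⟨p, by rw [← hp]; exact T.eq_form B⟩
  · rintro ⟨p, rfl⟩
    exact ⟨⟨hs p⟩, hinv p⟩
  · by_contra hn
    obtain ⟨x, ⟨i, hi⟩, hx⟩ := hdeg p hn
    refine hi (congrFun (hp.1 x fun y => ?_) i)
    rw [T.form_apply (M p) (show T.Alg from x), Finset.sum_comm]
    refine Finset.sum_eq_zero fun j _ => ?_
    rw [← Finset.sum_mul, hx j, zero_mul]
  · refine nondegenerate_of_symm (hs p) fun x hx => funext fun i => hnd p hp x (fun j => ?_) i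
    rw [← form_gen_right]
    exact hx _

end KleinTable

theorem GeneralInvariantForm.hasInvariantMetric {ι : Type} [Fintype ι] [DecidableEq ι]
    {T : KleinTable ι} {Par : Type} {M : Par → ι → ι → ℝ} {nd : Par → Prop}
    (h : GeneralInvariantForm T M nd) {p : Par} (hp : nd p) : HasInvariantMetric T.Alg :=
  ⟨_, (h.1 _).2 ⟨p, rfl⟩, (h.2 p).2 hp⟩

theorem GeneralInvariantForm.not_hasInvariantMetric {ι : Type} [Fintype ι] [DecidableEq ι]
    {T : KleinTable ι} {Par : Type} {M : Par → ι → ι → ℝ}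
    (h : GeneralInvariantForm T M fun _ => False) : ¬HasInvariantMetric T.Alg := by
  rintro ⟨B, hB, hnd⟩
  obtain ⟨p, rfl⟩ := (h.1 B).1 hB
  exact (h.2 p).1 hnd

namespace KinGen

theorem formMatrix_symm (jj jh hh bb pp bp bp' : ℝ) (i j : KinGen) :
    formMatrix jj jh hh bb pp bp bp' i j = formMatrix jj jh hh bb pp bp bp' j i := by
  obtain (_ | _ | a | a) := i <;> obtain (_ | _ | b | b) := j <;>
    simp [formMatrix, kron, eq_comm]

theorem form_formMatrix (T : KleinTable KinGen) (jj jh hh bb pp bp bp' : ℝ) (x y : T.Alg) :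
    T.form (formMatrix jj jh hh bb pp bp bp') x y =
      jj * (x J * y J) + jh * (x J * y H + x H * y J) + hh * (x H * y H) +
      bb * (x (B 0) * y (B 0) + x (B 1) * y (B 1)) +
      pp * (x (P 0) * y (P 0) + x (P 1) * y (P 1)) +
      bp * (x (B 0) * y (P 0) + x (B 1) * y (P 1) + x (P 0) * y (B 0) + x (P 1) * y (B 1)) +
      bp' * (x (B 0) * y (P 1) - x (B 1) * y (P 0) - x (P 0) * y (B 1) + x (P 1) * y (B 0)) := by
  simp [KleinTable.form_apply, sum_eq, formMatrix, kron, eps]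
  ring

theorem forall_iff {p : KinGen → Prop} :
    (∀ i, p i) ↔ p J ∧ p H ∧ p (B 0) ∧ p (B 1) ∧ p (P 0) ∧ p (P 1) := by
  constructor
  · intro h
    exact ⟨h _, h _, h _, h _, h _, h _⟩
  · rintro ⟨h1, h2, h3, h4, h5, h6⟩ (_ | _ | a | a)
    · exact h1
    · exact h2
    · fin_cases a
      exacts [h3, h4]
    · fin_cases a
      exacts [h5, h6]

/-- A symmetric matrix is of the form `formMatrix` if it has the right entries. -/
theorem eq_formMatrix {N : KinGen → KinGen → ℝ} {jj jh hh bb pp bp bp' : ℝ}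
    (hs : ∀ i j, N i j = N j i) (hJJ : N J J = jj) (hJH : N J H = jh) (hHH : N H H = hh)
    (hJB : ∀ a, N J (B a) = 0) (hJP : ∀ a, N J (P a) = 0)
    (hHB : ∀ a, N H (B a) = 0) (hHP : ∀ a, N H (P a) = 0)
    (hBB : ∀ a b, N (B a) (B b) = bb * kron a b) (hPP : ∀ a b, N (P a) (P b) = pp * kron a b)
    (hBP : ∀ a b, N (B a) (P b) = bp * kron a b + bp' * eps a b) :
    N = formMatrix jj jh hh bb pp bp bp' := by
  funext i j
  obtain (_ | _ | a | a) := i <;> obtain (_ | _ | b | b) := j <;>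
    first
    | simp only [formMatrix, hJJ, hJH, hHH, hJB, hJP, hHB, hHP, hBB, hPP, hBP]; done
    | rw [hs]; simp only [formMatrix, hJH, hJB, hJP, hHB, hHP, hBP]

/-- The entries of an invariant form in the directions that `J` rotates. -/
theorem entry_eq {T : KleinTable KinGen} (hTB : ∀ a, T.br (B a) J = -epsB a)
    (hTP : ∀ a, T.br (P a) J = -epsP a) {N : KinGen → KinGen → ℝ} (hs : ∀ i j, N i j = N j i)
    (h : ∀ i j k, ∑ m, T.br i j m * N m k = -∑ m, N j m * T.br i k m) (j : KinGen) :
    N j (B 0) = -(T.br (B 1) j J * N J J + T.br (B 1) j H * N J H) ∧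
    N j (B 1) = T.br (B 0) j J * N J J + T.br (B 0) j H * N J H ∧
    N j (P 0) = -(T.br (P 1) j J * N J J + T.br (P 1) j H * N J H) ∧
    N j (P 1) = T.br (P 0) j J * N J J + T.br (P 0) j H * N J H := by
  -- Invariance with `J` as last argument: the brackets `[v, J]` run, up to sign, through all boosts
  -- and translations as `v` does.
  have k0 := fun j => h (B 0) j J
  have k1 := fun j => h (B 1) j J
  have k2 := fun j => h (P 0) j J
  have k3 := fun j => h (P 1) j J
  simp only [hTB, hTP, sum_eq] at k0 k1 k2 k3
  simp [epsB, epsP, vec, eps, Fin.sum_univ_two] at k0 k1 k2 k3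
  -- For `j = J`, invariance says that the product of `J` with a boost or translation changes sign
  -- when its factors are exchanged, so by symmetry it is zero. For general `j` only the components
  -- of the brackets along `J` and `H` then contribute.
  have j0 := k0 J
  have j1 := k1 J
  have j2 := k2 J
  have j3 := k3 J
  simp [hTB, hTP, epsB, epsP, vec, eps, Fin.sum_univ_two] at j0 j1 j2 j3
  have n0 : N (B 0) J = 0 := by linarith [hs J (B 0)]
  have n1 : N (B 1) J = 0 := by linarith [hs J (B 1)]
  have n2 : N (P 0) J = 0 := by linarith [hs J (P 0)]
  have n3 : N (P 1) J = 0 := by linarith [hs J (P 1)]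
  have e0 := k0 j
  have e1 := k1 j
  have e2 := k2 j
  have e3 := k3 j
  rw [n0, n1, n2, n3, hs H J] at e0 e1 e2 e3
  refine ⟨?_, ?_, ?_, ?_⟩ <;> linarith

end KinGen

namespace AriGen

theorem formMatrix_symm (jj jh hh pp : ℝ) (i j : AriGen) :
    formMatrix jj jh hh pp i j = formMatrix jj jh hh pp j i := by
  obtain (_ | _ | a) := i <;> obtain (_ | _ | b) := j <;> simp [formMatrix, kron, eq_comm]

theorem form_formMatrix (T : KleinTable AriGen) (jj jh hh pp : ℝ) (x y : T.Alg) :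
    T.form (formMatrix jj jh hh pp) x y =
      jj * (x J * y J) + jh * (x J * y H + x H * y J) + hh * (x H * y H) +
      pp * (x (P 0) * y (P 0) + x (P 1) * y (P 1)) := by
  simp [KleinTable.form_apply, sum_eq, formMatrix, kron]
  ring

theorem forall_iff {p : AriGen → Prop} :
    (∀ i, p i) ↔ p J ∧ p H ∧ p (P 0) ∧ p (P 1) := by
  constructor
  · intro h
    exact ⟨h _, h _, h _, h _⟩
  · rintro ⟨h1, h2, h3, h4⟩ (_ | _ | a)
    · exact h1
    · exact h2
    · fin_cases a
      exacts [h3, h4]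

/-- A symmetric matrix is of the form `formMatrix` if it has the right entries. -/
theorem eq_formMatrix {N : AriGen → AriGen → ℝ} {jj jh hh pp : ℝ}
    (hs : ∀ i j, N i j = N j i) (hJJ : N J J = jj) (hJH : N J H = jh) (hHH : N H H = hh)
    (hJP : ∀ a, N J (P a) = 0) (hHP : ∀ a, N H (P a) = 0)
    (hPP : ∀ a b, N (P a) (P b) = pp * kron a b) :
    N = formMatrix jj jh hh pp := by
  funext i j
  obtain (_ | _ | a) := i <;> obtain (_ | _ | b) := j <;>
    first
    | simp only [formMatrix, hJJ, hJH, hHH, hJP, hHP, hPP]; done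
    | rw [hs]; simp only [formMatrix, hJH, hJP, hHP]

/-- The entries of an invariant form in the directions that `J` rotates. -/
theorem entry_eq {T : KleinTable AriGen} (hTP : ∀ a, T.br (P a) J = -epsP a)
    {N : AriGen → AriGen → ℝ} (hs : ∀ i j, N i j = N j i)
    (h : ∀ i j k, ∑ m, T.br i j m * N m k = -∑ m, N j m * T.br i k m) (j : AriGen) :
    N j (P 0) = -(T.br (P 1) j J * N J J + T.br (P 1) j H * N J H) ∧
    N j (P 1) = T.br (P 0) j J * N J J + T.br (P 0) j H * N J H := by
  have k0 := fun j => h (P 0) j J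
  have k1 := fun j => h (P 1) j J
  simp only [hTP, sum_eq] at k0 k1
  simp [epsP, vec, eps, Fin.sum_univ_two] at k0 k1
  have j0 := k0 J
  have j1 := k1 J
  simp [hTP, epsP, vec, eps, Fin.sum_univ_two] at j0 j1
  have n0 : N (P 0) J = 0 := by linarith [hs J (P 0)]
  have n1 : N (P 1) J = 0 := by linarith [hs J (P 1)]
  have e0 := k0 j
  have e1 := k1 j
  rw [n0, n1, hs H J] at e0 e1
  constructor <;> linarith

end AriGen

/-! ### Brackets by coordinates -/

theorem limitTable_lie (l t c : ℝ) (x y : (limitTable l t c).Alg) :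
    ⁅x, y⁆ KinGen.J = -(t * c) * (x (.B 0) * y (.B 1) - x (.B 1) * y (.B 0))
        - (l * c) * (x (.P 0) * y (.P 1) - x (.P 1) * y (.P 0)) ∧
    ⁅x, y⁆ KinGen.H = -c * (x (.B 0) * y (.P 1) - x (.B 1) * y (.P 0)
        - y (.B 0) * x (.P 1) + y (.B 1) * x (.P 0)) ∧
    ⁅x, y⁆ (KinGen.B 0) =
      -(x .J * y (.B 1) - x (.B 1) * y .J) - l * (x .H * y (.P 1) - x (.P 1) * y .H) ∧
    ⁅x, y⁆ (KinGen.B 1) =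
      x .J * y (.B 0) - x (.B 0) * y .J + l * (x .H * y (.P 0) - x (.P 0) * y .H) ∧
    ⁅x, y⁆ (KinGen.P 0) =
      -(x .J * y (.P 1) - x (.P 1) * y .J) - t * (x .H * y (.B 1) - x (.B 1) * y .H) ∧
    ⁅x, y⁆ (KinGen.P 1) =
      x .J * y (.P 0) - x (.P 0) * y .J + t * (x .H * y (.B 0) - x (.B 0) * y .H) := by
  have h := congrFun (KinGen.limitBr_bracket l t c x y)
  exact ⟨h .J, h .H, h (.B 0), h (.B 1), h (.P 0), h (.P 1)⟩

theorem torsionalTable_lie (α β β' α' : ℝ) (x y : (torsionalTable α β β' α').Alg) :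
    ⁅x, y⁆ KinGen.J = 0 ∧
    ⁅x, y⁆ KinGen.H = 0 ∧
    ⁅x, y⁆ (KinGen.B 0) =
      -(x .J * y (.B 1) - x (.B 1) * y .J) - α * (x .H * y (.P 1) - x (.P 1) * y .H)
        + α' * (x .H * y (.P 0) - x (.P 0) * y .H) ∧
    ⁅x, y⁆ (KinGen.B 1) =
      x .J * y (.B 0) - x (.B 0) * y .J + α * (x .H * y (.P 0) - x (.P 0) * y .H)
        + α' * (x .H * y (.P 1) - x (.P 1) * y .H) ∧
    ⁅x, y⁆ (KinGen.P 0) =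
      -(x .J * y (.P 1) - x (.P 1) * y .J) - (x .H * y (.B 1) - x (.B 1) * y .H)
        + β * (x .H * y (.P 0) - x (.P 0) * y .H) - β' * (x .H * y (.P 1) - x (.P 1) * y .H) ∧
    ⁅x, y⁆ (KinGen.P 1) =
      x .J * y (.P 0) - x (.P 0) * y .J + (x .H * y (.B 0) - x (.B 0) * y .H)
        + β * (x .H * y (.P 1) - x (.P 1) * y .H) + β' * (x .H * y (.P 0) - x (.P 0) * y .H) := by
  have h := congrFun (KinGen.torsionalBr_bracket α β β' α' x y)
  exact ⟨h .J, h .H, h (.B 0), h (.B 1), h (.P 0), h (.P 1)⟩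

theorem lightCone_lie (x y : lightCone.Alg) :
    ⁅x, y⁆ KinGen.J = -(x (.B 0) * y (.P 0) - x (.P 0) * y (.B 0) + x (.B 1) * y (.P 1)
        - x (.P 1) * y (.B 1)) ∧
    ⁅x, y⁆ KinGen.H = -(x (.B 0) * y (.P 1) - x (.B 1) * y (.P 0)
        - y (.B 0) * x (.P 1) + y (.B 1) * x (.P 0)) ∧
    ⁅x, y⁆ (KinGen.B 0) =
      -(x .J * y (.B 1) - x (.B 1) * y .J) + (x .H * y (.B 0) - x (.B 0) * y .H) ∧
    ⁅x, y⁆ (KinGen.B 1) =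
      x .J * y (.B 0) - x (.B 0) * y .J + (x .H * y (.B 1) - x (.B 1) * y .H) ∧
    ⁅x, y⁆ (KinGen.P 0) =
      -(x .J * y (.P 1) - x (.P 1) * y .J) - (x .H * y (.P 0) - x (.P 0) * y .H) ∧
    ⁅x, y⁆ (KinGen.P 1) =
      x .J * y (.P 0) - x (.P 0) * y .J - (x .H * y (.P 1) - x (.P 1) * y .H) := by
  have h := congrFun (KinGen.lightConeBr_bracket x y)
  exact ⟨h .J, h .H, h (.B 0), h (.B 1), h (.P 0), h (.P 1)⟩

theorem staticTable_lie (c : ℝ) (x y : (staticTable c).Alg) :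
    ⁅x, y⁆ AriGen.J = 0 ∧
    ⁅x, y⁆ AriGen.H = 0 ∧
    ⁅x, y⁆ (AriGen.P 0) =
      -(x .J * y (.P 1) - x (.P 1) * y .J) + c * (x .H * y (.P 0) - x (.P 0) * y .H) ∧
    ⁅x, y⁆ (AriGen.P 1) =
      x .J * y (.P 0) - x (.P 0) * y .J + c * (x .H * y (.P 1) - x (.P 1) * y .H) := by
  have h := congrFun (AriGen.staticBr_bracket c x y)
  exact ⟨h .J, h .H, h (.P 0), h (.P 1)⟩

theorem curvedTable_lie (u v : ℝ) (x y : (curvedTable u v).Alg) :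
    ⁅x, y⁆ AriGen.J = u * (x (.P 0) * y (.P 1) - x (.P 1) * y (.P 0)) ∧
    ⁅x, y⁆ AriGen.H = v * (x (.P 0) * y (.P 1) - x (.P 1) * y (.P 0)) ∧
    ⁅x, y⁆ (AriGen.P 0) = -(x .J * y (.P 1) - x (.P 1) * y .J) ∧
    ⁅x, y⁆ (AriGen.P 1) = x .J * y (.P 0) - x (.P 0) * y .J := by
  have h := congrFun (AriGen.curvedBr_bracket u v x y)
  exact ⟨h .J, h .H, h (.P 0), h (.P 1)⟩

/-! ### The invariant forms of the individual spacetimes -/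

theorem GeneralInvariantForm.reparametrize {ι : Type} [Fintype ι] [DecidableEq ι]
    {T : KleinTable ι} {Par Par' : Type} {M : Par → ι → ι → ℝ} {nd : Par → Prop}
    (h : GeneralInvariantForm T M nd) {f : Par' → Par} (hf : Function.Surjective f)
    {M' : Par' → ι → ι → ℝ} {nd' : Par' → Prop} (hM : ∀ q, M' q = M (f q))
    (hnd : ∀ q, nd' q ↔ nd (f q)) : GeneralInvariantForm T M' nd' := by
  refine ⟨fun B => (h.1 B).trans ⟨?_, ?_⟩, fun q => ?_⟩
  · rintro ⟨p, rfl⟩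
    obtain ⟨q, rfl⟩ := hf p
    exact ⟨q, by rw [hM]⟩
  · rintro ⟨q, rfl⟩
    exact ⟨f q, by rw [hM]⟩
  · rw [hM, hnd]
    exact h.2 _

-- In each of the pairs `(J, H)`, `(B_a, P_a)` the form is a two-by-two block whose determinant is,
-- up to sign and powers of `c`, equal to `μ² - l t χ²`.
open KinGen in
theorem generalInvariantForm_limitTable {l t c : ℝ} (hc : c ≠ 0) :
    GeneralInvariantForm (limitTable l t c)
      (fun p : ℝ × ℝ => formMatrix (-p.2) (-p.1) (-(l * t * p.2)) (c * t * p.2)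
        (c * l * p.2) (c * p.1) 0)
      (fun p => p.1 ^ 2 - l * t * p.2 ^ 2 ≠ 0) := by
  refine KleinTable.generalInvariantForm _ (fun p => formMatrix_symm _ _ _ _ _ _ _) ?_ ?_ ?_ ?_
  · rintro ⟨μ, χ⟩ z x y
    simp only [form_formMatrix, limitTable_lie]
    ring
  · intro N hs h
    have e := entry_eq (fun _ => rfl) (fun _ => rfl) hs h
    -- Since `[B₀, P₁] = -c H`, this relation gives `c ⟨H, H⟩ = c l t ⟨J, J⟩`; for `c = 0` it would
    -- leave `⟨H, H⟩` free.
    have hH := h (B 0) (P 1) H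
    simp [limitTable, limitBr, epsP, vec, eps, Fin.sum_univ_two, e] at hH
    refine ⟨(-N J H, -N J J), eq_formMatrix hs (by ring) (by ring)
      (mul_left_cancel₀ hc (by linear_combination hH)) ?_ ?_ ?_ ?_ ?_ ?_ ?_⟩
    all_goals
      simp only [Fin.forall_fin_two, e]
      simp [-mul_eq_mul_right_iff, limitTable, limitBr, epsB, epsP, vec, eps, kron,
        Fin.sum_univ_two] <;> ring
  · rintro ⟨μ, χ⟩ hp x hx
    simp only [forall_iff, sum_eq] at hx
    simp [formMatrix, kron, eps] at hx
    obtain ⟨h1, h2, h3, h4, h5, h6⟩ := hx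
    rw [forall_iff]
    have hp' : c * (μ ^ 2 - l * t * χ ^ 2) ≠ 0 := mul_ne_zero hc hp
    -- Cramer's rule in each block.
    refine ⟨mul_left_cancel₀ hp ?_, mul_left_cancel₀ hp ?_, mul_left_cancel₀ hp' ?_,
      mul_left_cancel₀ hp' ?_, mul_left_cancel₀ hp' ?_, mul_left_cancel₀ hp' ?_⟩
    · linear_combination l * t * χ * h1 - μ * h2
    · linear_combination χ * h2 - μ * h1
    · linear_combination μ * h5 - l * χ * h3
    · linear_combination μ * h6 - l * χ * h4
    · linear_combination μ * h3 - t * χ * h5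
    · linear_combination μ * h4 - t * χ * h6
  · rintro ⟨μ, χ⟩ hp
    have hp' : μ ^ 2 - l * t * χ ^ 2 = 0 := not_not.1 hp
    by_cases hμ : μ = 0 ∧ χ = 0
    · obtain ⟨rfl, rfl⟩ := hμ
      refine ⟨vec J, ⟨J, by simp [vec]⟩, ?_⟩
      simp [forall_iff, sum_eq, formMatrix]
    -- This vector is always orthogonal to `J`, and its product with `H` is `-(μ² - l t χ²)`.
    · refine ⟨μ • vec J - χ • vec H, ?_, ?_⟩
      · by_contra! hx
        exact hμ ⟨by simpa [vec] using hx J, by simpa [vec] using hx H⟩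
      · simp [forall_iff, sum_eq, formMatrix, vec]
        constructor
        · ring
        · linear_combination -hp'

-- Without brackets along `J` or `H`, `entry_eq` annihilates all entries outside the block of `J`
-- and `H`, while that block is not constrained at all. The translations then lie in the radical.
open KinGen in
theorem KinGen.generalInvariantForm_of_br_eq_zero {T : KleinTable KinGen}
    (hTB : ∀ a, T.br (B a) J = -epsB a) (hTP : ∀ a, T.br (P a) J = -epsP a)
    (hJ : ∀ i j, T.br i j J = 0) (hH : ∀ i j, T.br i j H = 0) :
    GeneralInvariantForm T (fun p : ℝ × ℝ × ℝ => formMatrix p.1 p.2.1 p.2.2 0 0 0 0)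
      (fun _ => False) := by
  refine T.generalInvariantForm (fun p => formMatrix_symm _ _ _ _ _ _ _) ?_ ?_ ?_ ?_
  · intro p z x y
    simp [form_formMatrix, KleinTable.bracket_apply, hJ, hH]
  · intro N hs h
    have e := entry_eq hTB hTP hs h
    refine ⟨(N J J, N J H, N H H), eq_formMatrix hs rfl rfl rfl ?_ ?_ ?_ ?_ ?_ ?_ ?_⟩ <;>
      simp [Fin.forall_fin_two, e, hJ, hH]
  · exact fun _ hp => hp.elim
  · refine fun p _ => ⟨vec (P 0), ⟨P 0, by simp [vec]⟩, ?_⟩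
    simp [forall_iff, formMatrix, vec]

open AriGen in
theorem AriGen.generalInvariantForm_of_br_eq_zero {T : KleinTable AriGen}
    (hTP : ∀ a, T.br (P a) J = -epsP a) (hJ : ∀ i j, T.br i j J = 0) (hH : ∀ i j, T.br i j H = 0) :
    GeneralInvariantForm T (fun p : ℝ × ℝ × ℝ => formMatrix p.1 p.2.1 p.2.2 0)
      (fun _ => False) := by
  refine T.generalInvariantForm (fun p => formMatrix_symm _ _ _ _) ?_ ?_ ?_ ?_
  · intro p z x y
    simp [form_formMatrix, KleinTable.bracket_apply, hJ, hH]
  · intro N hs h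
    have e := entry_eq hTP hs h
    refine ⟨(N J J, N J H, N H H), eq_formMatrix hs rfl rfl rfl ?_ ?_ ?_⟩ <;>
      simp [Fin.forall_fin_two, e, hJ, hH]
  · exact fun _ hp => hp.elim
  · refine fun p _ => ⟨vec (P 0), ⟨P 0, by simp [vec]⟩, ?_⟩
    simp [forall_iff, formMatrix, vec]

theorem generalInvariantForm_limitTable_zero (l t : ℝ) :
    GeneralInvariantForm (limitTable l t 0)
      (fun p : ℝ × ℝ × ℝ => KinGen.formMatrix p.1 p.2.1 p.2.2 0 0 0 0) (fun _ => False) := by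
  refine KinGen.generalInvariantForm_of_br_eq_zero (fun _ => rfl) (fun _ => rfl) ?_ ?_ <;>
    rintro (_ | _ | a | a) (_ | _ | b | b) <;>
      simp [limitTable, KinGen.limitBr, KinGen.epsB, KinGen.epsP, KinGen.vec]

theorem generalInvariantForm_torsionalTable (α β β' α' : ℝ) :
    GeneralInvariantForm (torsionalTable α β β' α')
      (fun p : ℝ × ℝ × ℝ => KinGen.formMatrix p.1 p.2.1 p.2.2 0 0 0 0) (fun _ => False) := by
  refine KinGen.generalInvariantForm_of_br_eq_zero (fun _ => rfl) (fun _ => rfl) ?_ ?_ <;>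
    rintro (_ | _ | a | a) (_ | _ | b | b) <;>
      simp [torsionalTable, KinGen.torsionalBr, KinGen.epsB, KinGen.epsP, KinGen.vec]

theorem generalInvariantForm_staticTable (c : ℝ) :
    GeneralInvariantForm (staticTable c)
      (fun p : ℝ × ℝ × ℝ => AriGen.formMatrix p.1 p.2.1 p.2.2 0) (fun _ => False) := by
  refine AriGen.generalInvariantForm_of_br_eq_zero (fun _ => rfl) ?_ ?_ <;>
    rintro (_ | _ | a) (_ | _ | b) <;>
      simp [staticTable, AriGen.staticBr, AriGen.epsP, AriGen.vec]

open KinGen in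
theorem generalInvariantForm_lightCone :
    GeneralInvariantForm lightCone
      (fun p : ℝ × ℝ => formMatrix p.2 p.1 (-p.2) 0 0 (-p.1) p.2)
      (fun p => p.1 ≠ 0 ∨ p.2 ≠ 0) := by
  refine KleinTable.generalInvariantForm _ (fun p => formMatrix_symm _ _ _ _ _ _ _) ?_ ?_ ?_ ?_
  · rintro ⟨μ, χ⟩ z x y
    simp only [form_formMatrix, lightCone_lie]
    ring
  · intro N hs h
    have e := entry_eq (fun _ => rfl) (fun _ => rfl) hs h
    -- Here `[B₀, P₁] = -H` and `[B₀, H] = -B₀`, so `⟨H, H⟩ = -⟨P₁, B₀⟩ = -⟨J, J⟩`.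
    have hH := h (B 0) (P 1) H
    simp [lightCone, lightConeBr, vec, eps, kron, e] at hH
    refine ⟨(N J H, N J J), eq_formMatrix hs rfl rfl (by linear_combination -hH)
      ?_ ?_ ?_ ?_ ?_ ?_ ?_⟩
    all_goals
      simp only [Fin.forall_fin_two, e]
      simp [lightCone, lightConeBr, epsB, epsP, vec, eps, kron, Fin.sum_univ_two]
  · rintro ⟨μ, χ⟩ hp x hx
    simp only [forall_iff, sum_eq] at hx
    simp [formMatrix, kron, eps] at hx
    obtain ⟨h1, h2, h3, h4, h5, h6⟩ := hx
    rw [forall_iff]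
    -- The form splits into two-by-two blocks of determinant `±(μ² + χ²)`.
    have hp' : μ ^ 2 + χ ^ 2 ≠ 0 := by
      rcases hp with hp | hp <;> positivity
    refine ⟨mul_left_cancel₀ hp' ?_, mul_left_cancel₀ hp' ?_, mul_left_cancel₀ hp' ?_,
      mul_left_cancel₀ hp' ?_, mul_left_cancel₀ hp' ?_, mul_left_cancel₀ hp' ?_⟩
    · linear_combination μ * h2 + χ * h1
    · linear_combination μ * h1 - χ * h2
    · linear_combination -μ * h5 + χ * h6
    · linear_combination -μ * h6 - χ * h5
    · linear_combination -μ * h3 - χ * h4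
    · linear_combination -μ * h4 + χ * h3
  · rintro ⟨μ, χ⟩ hp
    obtain ⟨rfl, rfl⟩ : μ = 0 ∧ χ = 0 := by simpa using hp
    refine ⟨vec J, ⟨J, by simp [vec]⟩, ?_⟩
    simp [forall_iff, sum_eq, formMatrix]

open AriGen in
theorem generalInvariantForm_curvedTable_J {σ : ℝ} (hσ : σ ≠ 0) :
    GeneralInvariantForm (curvedTable σ 0)
      (fun p : ℝ × ℝ => formMatrix p.1 0 p.2 (σ * p.1))
      (fun p => p.1 ≠ 0 ∧ p.2 ≠ 0) := by
  refine KleinTable.generalInvariantForm _ (fun p => formMatrix_symm _ _ _ _) ?_ ?_ ?_ ?_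
  · rintro ⟨χ, χH⟩ z x y
    simp only [form_formMatrix, curvedTable_lie]
    ring
  · intro N hs h
    have e := entry_eq (fun _ => rfl) hs h
    -- As `[P₀, P₁] = σ J` and `H` is central, `σ ⟨J, H⟩ = 0`.
    have hH := h (P 0) (P 1) H
    simp [curvedTable, curvedBr, vec, eps, hσ] at hH
    refine ⟨(N J J, N H H), eq_formMatrix hs rfl hH rfl ?_ ?_ ?_⟩
    all_goals
      simp only [Fin.forall_fin_two, e]
      simp [curvedTable, curvedBr, epsP, vec, eps, kron, Fin.sum_univ_two]
  · rintro ⟨χ, χH⟩ ⟨hχ, hχH⟩ x hx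
    simp only [forall_iff, sum_eq] at hx
    simpa [formMatrix, kron, hχ, hχH, hσ, forall_iff] using hx
  · rintro ⟨χ, χH⟩ hp
    by_cases hχ : χ = 0
    · subst hχ
      refine ⟨vec J, ⟨J, by simp [vec]⟩, ?_⟩
      simp [forall_iff, formMatrix, vec]
    · obtain rfl : χH = 0 := by
        by_contra hH
        exact hp ⟨hχ, hH⟩
      refine ⟨vec H, ⟨H, by simp [vec]⟩, ?_⟩
      simp [forall_iff, formMatrix, vec]

open AriGen in
theorem generalInvariantForm_spacetimeA24 :
    GeneralInvariantForm spacetimeA24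
      (fun p : ℝ × ℝ => formMatrix p.2 p.1 0 p.1)
      (fun p => p.1 ≠ 0) := by
  refine KleinTable.generalInvariantForm (curvedTable 0 1) (fun p => formMatrix_symm _ _ _ _)
    ?_ ?_ ?_ ?_
  · rintro ⟨χ, χJ⟩ z x y
    simp only [form_formMatrix, curvedTable_lie]
    ring
  · intro N hs h
    have e := entry_eq (fun _ => rfl) hs h
    -- As `[P₀, P₁] = H` is central, `⟨H, H⟩ = 0`.
    have hH := h (P 0) (P 1) H
    simp [curvedTable, curvedBr, vec, eps] at hH
    refine ⟨(N J H, N J J), eq_formMatrix hs rfl rfl hH ?_ ?_ ?_⟩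
    all_goals
      simp only [Fin.forall_fin_two, e]
      simp [curvedTable, curvedBr, epsP, vec, eps, kron, Fin.sum_univ_two]
  · rintro ⟨χ, χJ⟩ hp x hx
    have hχ : χ ≠ 0 := hp
    simp only [forall_iff, sum_eq] at hx
    simp [formMatrix, kron, hχ] at hx
    obtain ⟨h1, h2, h3, h4⟩ := hx
    rw [h2, zero_mul, zero_add] at h1
    exact forall_iff.2 ⟨h2, (mul_eq_zero.1 h1).resolve_right hχ, h3, h4⟩
  · rintro ⟨χ, χJ⟩ hp
    obtain rfl : χ = 0 := not_not.1 hp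
    refine ⟨vec H, ⟨H, by simp [vec]⟩, ?_⟩
    simp [forall_iff, formMatrix, vec]

/-! ### Dimensions by coordinates, and the subspace `V` of boosts and translations -/

namespace KleinTable

variable {ι : Type} [Fintype ι] (T : KleinTable ι)

theorem neg_apply (x : T.Alg) (k : ι) : (-x) k = -x k := rfl

theorem sub_apply (x y : T.Alg) (k : ι) : (x - y) k = x k - y k := rfl

attribute [simp] add_apply smul_apply zero_apply neg_apply sub_apply

variable {T}

theorem finrank_le_of_coord {n : ℕ} (c : Fin n → ι) (W : Submodule ℝ T.Alg)
    (h : ∀ x ∈ W, (∀ i, x (c i) = 0) → x = 0) : Module.finrank ℝ W ≤ n := by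
  let φ : W →ₗ[ℝ] (Fin n → ℝ) :=
    { toFun := fun x i => x.1 (c i), map_add' := fun _ _ => rfl, map_smul' := fun _ _ => rfl }
  have hφ : Function.Injective φ := (injective_iff_map_eq_zero φ).2 fun x hx =>
    Subtype.ext (h x.1 x.2 (congrFun hx))
  simpa using LinearMap.finrank_le_finrank_of_injective hφ

theorem finrank_eq_of_coord {n : ℕ} (c : Fin n → ι) (W : Submodule ℝ T.Alg)
    (h : ∀ x ∈ W, (∀ i, x (c i) = 0) → x = 0)
    (h' : ∀ y : Fin n → ℝ, ∃ x ∈ W, ∀ i, x (c i) = y i) : Module.finrank ℝ W = n := by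
  refine le_antisymm (finrank_le_of_coord c W h) ?_
  let φ : W →ₗ[ℝ] (Fin n → ℝ) :=
    { toFun := fun x i => x.1 (c i), map_add' := fun _ _ => rfl, map_smul' := fun _ _ => rfl }
  have hφ : Function.Surjective φ := fun y => by
    obtain ⟨x, hx, hxy⟩ := h' y
    exact ⟨⟨x, hx⟩, funext hxy⟩
  simpa using LinearMap.finrank_le_finrank_of_surjective hφ

end KleinTable

/-- If `I` were everything it would contain `J`, which would have to act trivially on `V`, against
`J² = -1`. This serves the static spacetimes, where `H` acts trivially and `ideal_le` does not
apply. -/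
theorem IsRotationSplit.finrank_lt {k : Type*} [LieRing k] [LieAlgebra ℝ k]
    [FiniteDimensional ℝ k] {J H : k} {V : Submodule ℝ k} (hV : IsRotationSplit J H V)
    (h' : ∀ v ∈ V, ⁅H, v⁆ ∈ V) {v : k} (hv : v ∈ V) (hv0 : v ≠ 0) {I : LieIdeal ℝ k}
    {F : LinearMap.BilinForm ℝ k} (hF : IsInvariantMetricOn I F) :
    Module.finrank ℝ I < Module.finrank ℝ k := by
  refine Submodule.finrank_lt fun hI => hv0 ?_
  have hJ : (1 : ℝ) • J + (0 : ℝ) • H ∈ I := by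
    change _ ∈ I.toSubmodule
    rw [hI]
    trivial
  have h1 := hV.torus_lie_eq_zero hF hJ h' hv
  rw [one_smul, zero_smul, add_zero] at h1
  rw [← neg_eq_zero, ← hV.J_J v hv, h1, lie_zero]

namespace KinGen

variable (T : KleinTable KinGen)

theorem card_eq : Fintype.card KinGen = 6 := rfl

variable {T} in
theorem alg_ext {x y : T.Alg} (hJ : x J = y J) (hH : x H = y H) (hB0 : x (B 0) = y (B 0))
    (hB1 : x (B 1) = y (B 1)) (hP0 : x (P 0) = y (P 0)) (hP1 : x (P 1) = y (P 1)) : x = y :=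
  funext (forall_iff.2 ⟨hJ, hH, hB0, hB1, hP0, hP1⟩)

/-- The span of the boosts and spatial translations. -/
def vectors : Submodule ℝ T.Alg where
  carrier := {x | x J = 0 ∧ x H = 0}
  add_mem' hx hy := ⟨by rw [T.add_apply, hx.1, hy.1, add_zero],
    by rw [T.add_apply, hx.2, hy.2, add_zero]⟩
  zero_mem' := ⟨rfl, rfl⟩
  smul_mem' r x hx := ⟨by rw [T.smul_apply, hx.1, mul_zero], by rw [T.smul_apply, hx.2, mul_zero]⟩

variable {T} in
theorem mem_vectors {x : T.Alg} : x ∈ vectors T ↔ x J = 0 ∧ x H = 0 := Iff.rfl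

theorem finrank_le_of_le_vectors (I : LieIdeal ℝ T.Alg) (h : ∀ x ∈ I, x ∈ vectors T) :
    Module.finrank ℝ I ≤ 4 := by
  refine KleinTable.finrank_le_of_coord ![B 0, B 1, P 0, P 1] I.toSubmodule fun x hx h0 => ?_
  exact alg_ext (h x hx).1 (h x hx).2 (h0 0) (h0 1) (h0 2) (h0 3)

variable {T} in
theorem exists_torus_add_vectors (x : T.Alg) :
    ∃ r s : ℝ, ∃ v ∈ vectors T, x = (r • T.gen J + s • T.gen H) + v := by
  refine ⟨x J, x H, x - (x J • T.gen J + x H • T.gen H), ?_, by abel⟩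
  simp [mem_vectors, T.gen_apply]

end KinGen

namespace AriGen

variable (T : KleinTable AriGen)

theorem card_eq : Fintype.card AriGen = 4 := rfl

variable {T} in
theorem alg_ext {x y : T.Alg} (hJ : x J = y J) (hH : x H = y H)
    (hP0 : x (P 0) = y (P 0)) (hP1 : x (P 1) = y (P 1)) : x = y :=
  funext (forall_iff.2 ⟨hJ, hH, hP0, hP1⟩)

/-- The span of the spatial translations. -/
def vectors : Submodule ℝ T.Alg where
  carrier := {x | x J = 0 ∧ x H = 0}
  add_mem' hx hy := ⟨by rw [T.add_apply, hx.1, hy.1, add_zero],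
    by rw [T.add_apply, hx.2, hy.2, add_zero]⟩
  zero_mem' := ⟨rfl, rfl⟩
  smul_mem' r x hx := ⟨by rw [T.smul_apply, hx.1, mul_zero], by rw [T.smul_apply, hx.2, mul_zero]⟩

variable {T} in
theorem mem_vectors {x : T.Alg} : x ∈ vectors T ↔ x J = 0 ∧ x H = 0 := Iff.rfl

variable {T} in
theorem exists_torus_add_vectors (x : T.Alg) :
    ∃ r s : ℝ, ∃ v ∈ vectors T, x = (r • T.gen J + s • T.gen H) + v := by
  refine ⟨x J, x H, x - (x J • T.gen J + x H • T.gen H), ?_, by abel⟩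
  simp [mem_vectors, T.gen_apply]

end AriGen

/-! ### Galilean limits (`c = 0`) -/

section Limit

open KinGen KleinTable

variable (l t : ℝ)

theorem isRotationSplit_limitTable :
    IsRotationSplit ((limitTable l t 0).gen J) ((limitTable l t 0).gen H) (vectors _) where
  comm := by
    apply alg_ext <;> simp [limitTable_lie, gen_apply]
  abelian v hv w hw := by
    obtain ⟨h1, h2⟩ := mem_vectors.1 hv
    obtain ⟨h3, h4⟩ := mem_vectors.1 hw
    apply alg_ext <;> simp [limitTable_lie, h1, h2, h3, h4]
  mem_J v hv := by simp [mem_vectors, limitTable_lie]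
  J_J v hv := by
    obtain ⟨h1, h2⟩ := mem_vectors.1 hv
    apply alg_ext <;> simp [limitTable_lie, gen_apply, h1, h2]
  span := exists_torus_add_vectors

theorem limitTable_lie_mem_vectors (x v : (limitTable l t 0).Alg) : ⁅x, v⁆ ∈ vectors _ := by
  simp [mem_vectors, limitTable_lie]

/-- `rJ + sH` sends `B₀` to `r B₁ + s t P₁` and `P₀` to `r P₁ + s l B₁`. So `J` and `H` act
independently unless `l = t = 0`, and the ideal lies in the four-dimensional `V`. -/
theorem finrank_ideal_limitTable_le (hlt : l ≠ 0 ∨ t ≠ 0) (I : LieIdeal ℝ (limitTable l t 0).Alg)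
    (F : LinearMap.BilinForm ℝ (limitTable l t 0).Alg) (hF : IsInvariantMetricOn I F) :
    Module.finrank ℝ I ≤ 4 := by
  refine finrank_le_of_le_vectors _ I fun x hx => (isRotationSplit_limitTable l t).ideal_le hF
    (fun v _ => limitTable_lie_mem_vectors l t _ v) (fun r s h => ?_) hx
  have hB := h (gen _ (B 0)) (by simp [mem_vectors, gen_apply])
  have hP := h (gen _ (P 0)) (by simp [mem_vectors, gen_apply])
  have h1 := congrFun hB (B 1)
  have h2 := congrFun hB (P 1)
  have h3 := congrFun hP (B 1)
  rw [KleinTable.zero_apply] at h1 h2 h3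
  simp [limitTable_lie, gen_apply] at h1 h2 h3
  refine ⟨h1, ?_⟩
  rcases hlt with hl | ht
  · exact h3.resolve_left hl
  · exact h2.resolve_left ht

theorem finrank_ideal_limitTable_lt (I : LieIdeal ℝ (limitTable l t 0).Alg)
    (F : LinearMap.BilinForm ℝ (limitTable l t 0).Alg) (hF : IsInvariantMetricOn I F) :
    Module.finrank ℝ I ≤ 5 := by
  have h := (isRotationSplit_limitTable l t).finrank_lt
    (fun v _ => limitTable_lie_mem_vectors l t _ v) (v := gen _ (B 0))
    (by simp [mem_vectors, gen_apply]) (fun h0 => by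
      have := congrFun h0 (B 0)
      rw [KleinTable.zero_apply] at this
      simp [gen_apply] at this) hF
  rw [finrank_alg, card_eq] at h
  omega

/-- The ideal of boosts and spatial translations. -/
def limitIdeal : LieIdeal ℝ (limitTable l t 0).Alg where
  toSubmodule := vectors _
  lie_mem {x v} _ := limitTable_lie_mem_vectors l t x v

/-- `H` exchanges boosts and translations through `ε`, so it is skew for the pairing `⟨B_a, P_b⟩ =
δ_ab`, whatever `l` and `t` are; so is `J`. -/
theorem isInvariantMetricOn_limitIdeal :
    IsInvariantMetricOn (limitIdeal l t)
      ((limitTable l t 0).form (formMatrix 0 0 0 0 0 1 0)) where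
  symm x _ y _ := by
    simp only [form_formMatrix]
    ring
  inv z x hx y hy := by
    obtain ⟨h1, h2⟩ := mem_vectors.1 hx
    obtain ⟨h3, h4⟩ := mem_vectors.1 hy
    simp only [form_formMatrix, limitTable_lie, h1, h2, h3, h4]
    ring
  nondeg x hx h := by
    have hg : ∀ {i}, i ≠ J → i ≠ H → gen _ i ∈ limitIdeal l t := fun h1 h2 =>
      mem_vectors.2 ⟨by simp [gen_apply, h1.symm], by simp [gen_apply, h2.symm]⟩
    have e1 := h _ (hg (i := B 0) (by simp) (by simp))
    have e2 := h _ (hg (i := B 1) (by simp) (by simp))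
    have e3 := h _ (hg (i := P 0) (by simp) (by simp))
    have e4 := h _ (hg (i := P 1) (by simp) (by simp))
    simp [form_formMatrix, gen_apply] at e1 e2 e3 e4
    exact alg_ext hx.1 hx.2 e3 e4 e1 e2

/-- The span of the rotation and the time translation. -/
def limitTorus : LieSubalgebra ℝ (limitTable l t 0).Alg where
  carrier := {x | x (B 0) = 0 ∧ x (B 1) = 0 ∧ x (P 0) = 0 ∧ x (P 1) = 0}
  add_mem' {x y} hx hy := by simp_all
  zero_mem' := ⟨rfl, rfl, rfl, rfl⟩
  smul_mem' r x hx := by simp_all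
  lie_mem' {x y} hx hy := by simp_all [limitTable_lie]

theorem finrank_limitTorus : Module.finrank ℝ (limitTorus l t) = 2 := by
  refine finrank_eq_of_coord ![J, H] (limitTorus l t).toSubmodule (fun x hx h => ?_) fun y => ?_
  · obtain ⟨h1, h2, h3, h4⟩ := hx
    exact alg_ext (h 0) (h 1) h1 h2 h3 h4
  · refine ⟨y 0 • gen _ J + y 1 • gen _ H, ⟨?_, ?_, ?_, ?_⟩, Fin.forall_fin_two.2 ⟨?_, ?_⟩⟩ <;>
      simp [gen_apply]

theorem hasCentralDoubleExtensionTheory_limitTable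
    (b : LieSubalgebra ℝ (limitTable l t 0).Alg) : HasCentralDoubleExtensionTheory b 2 := by
  rw [← finrank_limitTorus l t]
  refine hasCentralDoubleExtensionTheory_of_ideal b (isInvariantMetricOn_limitIdeal l t) _ ?_ ?_ ?_
  · intro x
    obtain ⟨r, s, v, hv, rfl⟩ := exists_torus_add_vectors x
    refine ⟨v, hv, r • gen _ J + s • gen _ H, ⟨?_, ?_, ?_, ?_⟩, add_comm _ _⟩ <;>
      simp [gen_apply]
  · rintro x ⟨h1, h2⟩ ⟨h3, h4, h5, h6⟩
    exact alg_ext h1 h2 h3 h4 h5 h6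
  · rintro x ⟨h1, h2, h3, h4⟩ y ⟨h5, h6, h7, h8⟩
    apply alg_ext <;> simp [limitTable_lie, h1, h2, h3, h4, h5, h6, h7, h8]

/-- The ideal spanned by all generators but the rotation. -/
def staticIdeal : LieIdeal ℝ (limitTable 0 0 0).Alg where
  carrier := {x | x J = 0}
  add_mem' {x y} hx hy := by simp_all
  zero_mem' := rfl
  smul_mem' r x hx := by simp_all
  lie_mem {x v} _ := (limitTable_lie_mem_vectors 0 0 x v).1

/-- `H` is central for `l = t = 0`, so it can be kept in the ideal; only the rotation acts, and the
euclidean form is invariant. -/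
theorem isInvariantMetricOn_staticIdeal :
    IsInvariantMetricOn staticIdeal ((limitTable 0 0 0).form (formMatrix 0 0 1 1 1 0 0)) where
  symm x _ y _ := by
    simp only [form_formMatrix]
    ring
  inv z x hx y hy := by
    have h1 : x J = 0 := hx
    have h2 : y J = 0 := hy
    simp only [form_formMatrix, limitTable_lie, h1, h2]
    ring
  nondeg x hx h := by
    have hg : ∀ {i}, i ≠ J → gen _ i ∈ staticIdeal := fun h1 => by
      change gen _ _ J = 0
      simp [gen_apply, h1.symm]
    have e0 := h _ (hg (i := H) (by simp))
    have e1 := h _ (hg (i := B 0) (by simp))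
    have e2 := h _ (hg (i := B 1) (by simp))
    have e3 := h _ (hg (i := P 0) (by simp))
    have e4 := h _ (hg (i := P 1) (by simp))
    simp [form_formMatrix, gen_apply] at e0 e1 e2 e3 e4
    exact alg_ext hx e0 e1 e2 e3 e4

/-- The span of the rotation. -/
def staticRotation : LieSubalgebra ℝ (limitTable 0 0 0).Alg where
  carrier := {x | x H = 0 ∧ x (B 0) = 0 ∧ x (B 1) = 0 ∧ x (P 0) = 0 ∧ x (P 1) = 0}
  add_mem' {x y} hx hy := by simp_all
  zero_mem' := ⟨rfl, rfl, rfl, rfl, rfl⟩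
  smul_mem' r x hx := by simp_all
  lie_mem' {x y} hx hy := by simp_all [limitTable_lie]

theorem finrank_staticRotation : Module.finrank ℝ staticRotation = 1 := by
  refine finrank_eq_of_coord ![J] staticRotation.toSubmodule (fun x hx h => ?_) fun y => ?_
  · obtain ⟨h1, h2, h3, h4, h5⟩ := hx
    exact alg_ext (h 0) h1 h2 h3 h4 h5
  · refine ⟨y 0 • gen _ J, ⟨?_, ?_, ?_, ?_, ?_⟩, fun i => ?_⟩
    on_goal 6 => obtain rfl := Subsingleton.elim i 0
    all_goals simp [gen_apply]

theorem hasCentralDoubleExtensionTheory_limitTable_static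
    (b : LieSubalgebra ℝ (limitTable 0 0 0).Alg) : HasCentralDoubleExtensionTheory b 1 := by
  rw [← finrank_staticRotation]
  refine hasCentralDoubleExtensionTheory_of_ideal b isInvariantMetricOn_staticIdeal _ ?_ ?_ ?_
  · intro x
    refine ⟨x - x J • gen _ J, ?_, x J • gen _ J, ⟨?_, ?_, ?_, ?_, ?_⟩, by abel⟩
    · change (x - x J • gen (limitTable 0 0 0) J) J = 0
      simp [gen_apply]
    all_goals simp [gen_apply]
  · rintro x h1 ⟨h2, h3, h4, h5, h6⟩
    exact alg_ext h1 h2 h3 h4 h5 h6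
  · rintro x ⟨h1, h2, h3, h4, h5⟩ y ⟨h6, h7, h8, h9, h10⟩
    apply alg_ext <;> simp_all [limitTable_lie]

end Limit

/-! ### Torsional galilean spacetimes -/

section Torsional

open KinGen KleinTable

variable (α β β' α' : ℝ)

theorem isRotationSplit_torsionalTable :
    IsRotationSplit ((torsionalTable α β β' α').gen J) ((torsionalTable α β β' α').gen H)
      (vectors _) where
  comm := by
    apply alg_ext <;> simp [torsionalTable_lie, gen_apply]
  abelian v hv w hw := by
    obtain ⟨h1, h2⟩ := mem_vectors.1 hv
    obtain ⟨h3, h4⟩ := mem_vectors.1 hw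
    apply alg_ext <;> simp [torsionalTable_lie, h1, h2, h3, h4]
  mem_J v hv := by simp [mem_vectors, torsionalTable_lie]
  J_J v hv := by
    obtain ⟨h1, h2⟩ := mem_vectors.1 hv
    apply alg_ext <;> simp [torsionalTable_lie, gen_apply, h1, h2]
  span := exists_torus_add_vectors

theorem torsionalTable_lie_mem_vectors (x v : (torsionalTable α β β' α').Alg) :
    ⁅x, v⁆ ∈ vectors _ := by
  simp [mem_vectors, torsionalTable_lie]

variable {α β β' α'} {I : LieIdeal ℝ (torsionalTable α β β' α').Alg}
  {F : LinearMap.BilinForm ℝ (torsionalTable α β β' α').Alg}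

theorem mem_vectors_of_mem_ideal_torsionalTable (hF : IsInvariantMetricOn I F)
    {x : (torsionalTable α β β' α').Alg} (hx : x ∈ I) :
    x ∈ vectors _ := by
  refine (isRotationSplit_torsionalTable α β β' α').ideal_le hF
    (fun v _ => torsionalTable_lie_mem_vectors _ _ _ _ _ v) (fun r s h => ?_) hx
  have hB := h (gen _ (B 0)) (by simp [mem_vectors, gen_apply])
  have h1 := congrFun hB (B 1)
  have h2 := congrFun hB (P 1)
  rw [KleinTable.zero_apply] at h1 h2
  simp [torsionalTable_lie, gen_apply] at h1 h2
  exact ⟨h1, h2⟩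

/-- The coordinates of `βH + α'J = 0` on the ideal. With `J` as imaginary unit, `H` on `V` is a
complex two-by-two matrix of trace `β + β'J` and determinant `α - α'J`; the quadratic relation is
its characteristic equation. -/
theorem ideal_torsionalTable_relations (hF : IsInvariantMetricOn I F)
    {x : (torsionalTable α β β' α').Alg} (hx : x ∈ I) :
    β * (-α * x (P 1) + α' * x (P 0)) - α' * x (B 1) = 0 ∧
    β * (α * x (P 0) + α' * x (P 1)) + α' * x (B 0) = 0 ∧
    β * (-x (B 1) + β * x (P 0) - β' * x (P 1)) - α' * x (P 1) = 0 ∧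
    β * (x (B 0) + β * x (P 1) + β' * x (P 0)) + α' * x (P 0) = 0 := by
  have h := (isRotationSplit_torsionalTable α β β' α').linear_relation hF
    (fun y hy => mem_vectors_of_mem_ideal_torsionalTable hF hy)
    (α := α) (β := β) (β' := β') (α' := α') (fun v hv => by
      obtain ⟨h1, h2⟩ := mem_vectors.1 hv
      apply alg_ext <;> simp [torsionalTable_lie, gen_apply, h1, h2] <;> ring) hx
  obtain ⟨h1, h2⟩ := mem_vectors.1 (mem_vectors_of_mem_ideal_torsionalTable hF hx)
  have e1 := congrFun h (B 0)
  have e2 := congrFun h (B 1)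
  have e3 := congrFun h (P 0)
  have e4 := congrFun h (P 1)
  rw [KleinTable.zero_apply] at e1 e2 e3 e4
  simp [torsionalTable_lie, gen_apply, h1, h2] at e1 e2 e3 e4
  refine ⟨?_, ?_, ?_, ?_⟩ <;> linarith

theorem eq_zero_of_mem_ideal_torsionalTable (hF : IsInvariantMetricOn I F)
    (h : β ≠ 0 ∨ α' ≠ 0)
    {x : (torsionalTable α β β' α').Alg} (hx : x ∈ I) (hP0 : x (P 0) = 0) (hP1 : x (P 1) = 0) :
    x = 0 := by
  obtain ⟨h1, h2⟩ := mem_vectors.1 (mem_vectors_of_mem_ideal_torsionalTable hF hx)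
  obtain ⟨e1, e2, e3, e4⟩ := ideal_torsionalTable_relations hF hx
  simp [hP0, hP1] at e1 e2 e3 e4
  rcases h with h | h
  · exact alg_ext h1 h2 (e4.resolve_left h) (e3.resolve_left h) hP0 hP1
  · exact alg_ext h1 h2 (e2.resolve_left h) (e1.resolve_left h) hP0 hP1

theorem finrank_ideal_torsionalTable_le_two (hF : IsInvariantMetricOn I F)
    (h : β ≠ 0 ∨ α' ≠ 0) : Module.finrank ℝ I ≤ 2 :=
  finrank_le_of_coord ![P 0, P 1] I.toSubmodule fun _ hx h0 =>
    eq_zero_of_mem_ideal_torsionalTable hF h hx (h0 0) (h0 1)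

/-- For `β ≠ 0` the linear relation forces `H = -(α'/β) J` on the ideal. The characteristic equation
has this root exactly if `β²α - βα'β' - α'²` vanishes. -/
theorem finrank_ideal_torsionalTable_le_zero (hF : IsInvariantMetricOn I F)
    (h : β ^ 2 * α - β * α' * β' - α' ^ 2 ≠ 0) :
    Module.finrank ℝ I ≤ 0 := by
  refine finrank_le_of_coord Fin.elim0 I.toSubmodule fun x hx _ => ?_
  obtain ⟨e1, e2, e3, e4⟩ := ideal_torsionalTable_relations hF hx
  refine eq_zero_of_mem_ideal_torsionalTable hF ?_ hx (mul_left_cancel₀ h ?_)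
    (mul_left_cancel₀ h ?_)
  · by_contra! h0
    simp [h0.1, h0.2] at h
  · linear_combination β * e2 - α' * e4
  · linear_combination -β * e1 + α' * e3

/-- An ideal that contains all brackets contains `P₀ = -[J, [J, P₀]]`, and the relations for `P₀`
give `β² = 0` and then `α' = 0`. -/
theorem not_hasCentralTheory_torsionalTable (h : β ≠ 0 ∨ α' ≠ 0)
    (b : LieSubalgebra ℝ (torsionalTable α β β' α').Alg) (n : ℕ) : ¬HasCentralTheory b n := by
  refine not_hasCentralTheory (fun I F hF => ?_) n
  by_contra! hI
  have hP : gen _ (P 0) ∈ I := by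
    rw [← neg_neg (gen _ (P 0)), ← (isRotationSplit_torsionalTable α β β' α').J_J (gen _ (P 0))
      (by simp [mem_vectors, gen_apply])]
    exact I.neg_mem (hI _ _)
  obtain ⟨-, -, e3, e4⟩ := ideal_torsionalTable_relations hF hP
  simp [gen_apply] at e3 e4
  simp_all

theorem isMinimalAdded_torsionalTable (h : β ^ 2 * α - β * α' * β' - α' ^ 2 ≠ 0)
    (b : LieSubalgebra ℝ (torsionalTable α β β' α').Alg) : IsMinimalAdded b 6 := by
  have h6 : Module.finrank ℝ (torsionalTable α β β' α').Alg = 6 := finrank_alg _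
  have hD := (hasCoadjointTheory b).hasDoubleExtensionTheory
  rw [h6] at hD
  exact hD.isMinimalAdded (d := 0) h6 fun I F hF => finrank_ideal_torsionalTable_le_zero hF h

-- For `α = 0`, `β = 1`, `β' = -χ`, `α' = χ` the characteristic equation factors as `(H - 1)(H + χJ)
-- = 0`. The eigenspace `H = -χJ` is the ideal, and the eigenspace `H = 1` together with `J`, `H` is
-- the complement.
variable (χ : ℝ)

/-- The eigenspace on which `H` acts as a multiple of the rotation `J`. -/
def ellipticIdeal : LieIdeal ℝ (torsionalTable 0 1 (-χ) χ).Alg where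
  carrier := {x | x J = 0 ∧ x H = 0 ∧ x (P 0) = x (B 1) ∧ x (P 1) = -x (B 0)}
  add_mem' {x y} hx hy := by
    simp_all
    ring
  zero_mem' := by simp
  smul_mem' r x hx := by simp_all
  lie_mem {x v} hv := by
    obtain ⟨h1, h2, h3, h4⟩ := hv
    change _ ∧ _ ∧ _ ∧ _
    simp only [torsionalTable_lie, h1, h2, h3, h4, true_and]
    constructor <;> ring

/-- Here `H` acts as `-χJ`, so rotational invariance suffices. The boost components are coordinates
on the ideal, and the form is the euclidean one in them. -/
theorem isInvariantMetricOn_ellipticIdeal :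
    IsInvariantMetricOn (ellipticIdeal χ)
      ((torsionalTable 0 1 (-χ) χ).form (formMatrix 0 0 0 1 0 0 0)) where
  symm x _ y _ := by
    simp only [form_formMatrix]
    ring
  inv z x hx y hy := by
    obtain ⟨h1, h2, h3, h4⟩ := hx
    obtain ⟨h5, h6, h7, h8⟩ := hy
    simp only [form_formMatrix, torsionalTable_lie, h1, h2, h3, h4, h5, h6, h7, h8]
    ring
  nondeg x hx h := by
    obtain ⟨h1, h2, h3, h4⟩ := hx
    have e0 := h (gen _ (B 0) - gen _ (P 1)) ⟨by simp [gen_apply], by simp [gen_apply],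
      by simp [gen_apply], by simp [gen_apply]⟩
    have e1 := h (gen _ (B 1) + gen _ (P 0)) ⟨by simp [gen_apply], by simp [gen_apply],
      by simp [gen_apply], by simp [gen_apply]⟩
    simp only [form_formMatrix] at e0 e1
    simp [gen_apply] at e0 e1
    rw [e1] at h3
    rw [e0, neg_zero] at h4
    exact alg_ext h1 h2 e0 e1 h3 h4

/-- The subalgebra spanned by `J`, `H` and the eigenspace of `H` with eigenvalue `1`. -/
def hyperbolicSubalgebra : LieSubalgebra ℝ (torsionalTable 0 1 (-χ) χ).Alg where
  carrier := {x | x (B 0) = χ * x (P 0) ∧ x (B 1) = χ * x (P 1)}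
  add_mem' {x y} hx hy := by simp_all [mul_add]
  zero_mem' := by simp
  smul_mem' r x hx := by simp_all [mul_left_comm]
  lie_mem' {x y} hx hy := by
    obtain ⟨h1, h2⟩ := hx
    obtain ⟨h3, h4⟩ := hy
    change _ ∧ _
    simp only [torsionalTable_lie, h1, h2, h3, h4]
    constructor <;> ring

theorem finrank_hyperbolicSubalgebra : Module.finrank ℝ (hyperbolicSubalgebra χ) = 4 := by
  refine finrank_eq_of_coord ![J, H, P 0, P 1] (hyperbolicSubalgebra χ).toSubmodule
    (fun x hx h => ?_) fun y => ?_
  · obtain ⟨h1, h2⟩ := hx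
    have h3 : x (P 0) = 0 := h 2
    have h4 : x (P 1) = 0 := h 3
    rw [h3, mul_zero] at h1
    rw [h4, mul_zero] at h2
    exact alg_ext (h 0) (h 1) h1 h2 h3 h4
  · refine ⟨y 0 • gen _ J + y 1 • gen _ H + y 2 • gen _ (P 0) + y 3 • gen _ (P 1) +
      (χ * y 2) • gen _ (B 0) + (χ * y 3) • gen _ (B 1), ⟨?_, ?_⟩, fun i => ?_⟩
    · simp [gen_apply]
    · simp [gen_apply]
    · fin_cases i <;> simp [gen_apply]

theorem hasDoubleExtensionTheory_torsionalTable
    (b : LieSubalgebra ℝ (torsionalTable 0 1 (-χ) χ).Alg) : HasDoubleExtensionTheory b 4 := by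
  rw [← finrank_hyperbolicSubalgebra χ]
  have hχ : 1 + χ ^ 2 ≠ 0 := by positivity
  refine hasDoubleExtensionTheory_of_ideal b (isInvariantMetricOn_ellipticIdeal χ) _ ?_ ?_
  · intro x
    -- `u` and `v` solve the two linear equations which say that subtracting `u (B₀ - P₁) + v (B₁ +
    -- P₀)` from `x` lands in the subalgebra; their determinant is `1 + χ²`.
    let u : ℝ := (x (B 0) - χ * x (P 0) + χ * (x (B 1) - χ * x (P 1))) / (1 + χ ^ 2)
    let v : ℝ := (x (B 1) - χ * x (P 1) - χ * (x (B 0) - χ * x (P 0))) / (1 + χ ^ 2)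
    have hu : u - χ * v = x (B 0) - χ * x (P 0) := by
      simp only [u, v]
      field_simp
      ring
    have hv : v + χ * u = x (B 1) - χ * x (P 1) := by
      simp only [u, v]
      field_simp
      ring
    let w : (torsionalTable 0 1 (-χ) χ).Alg :=
      u • (gen _ (B 0) - gen _ (P 1)) + v • (gen _ (B 1) + gen _ (P 0))
    have wB0 : w (B 0) = u := by simp [w, gen_apply]
    have wB1 : w (B 1) = v := by simp [w, gen_apply]
    have wP0 : w (P 0) = v := by simp [w, gen_apply]
    have wP1 : w (P 1) = -u := by simp [w, gen_apply]
    refine ⟨w, ⟨by simp [w, gen_apply], by simp [w, gen_apply], by rw [wP0, wB1],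
      by rw [wP1, wB0]⟩, x - w, ⟨?_, ?_⟩, by abel⟩
    · rw [KleinTable.sub_apply, KleinTable.sub_apply, wB0, wP0]
      linarith
    · rw [KleinTable.sub_apply, KleinTable.sub_apply, wB1, wP1]
      linarith
  · rintro x ⟨h1, h2, h3, h4⟩ ⟨h5, h6⟩
    rw [h3] at h5
    rw [h4] at h6
    have h7 : x (B 0) = 0 := mul_left_cancel₀ hχ (by linear_combination h5 + χ * h6)
    have h8 : x (B 1) = 0 := by rw [h6, h7, neg_zero, mul_zero]
    rw [h8] at h3
    rw [h7, neg_zero] at h4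
    exact alg_ext h1 h2 h7 h8 h3 h4

theorem isMinimalAdded_torsionalTable_elliptic
    (b : LieSubalgebra ℝ (torsionalTable 0 1 (-χ) χ).Alg) : IsMinimalAdded b 4 :=
  (hasDoubleExtensionTheory_torsionalTable χ b).isMinimalAdded (d := 2) (finrank_alg _)
    fun _ _ hF => finrank_ideal_torsionalTable_le_two hF (Or.inl one_ne_zero)

end Torsional

/-! ### Aristotelian static and torsional static spacetimes -/

section Static

open AriGen KleinTable

variable (c : ℝ)

theorem isRotationSplit_staticTable :
    IsRotationSplit ((staticTable c).gen J) ((staticTable c).gen H) (vectors _) where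
  comm := by
    apply alg_ext <;> simp [staticTable_lie, gen_apply]
  abelian v hv w hw := by
    obtain ⟨h1, h2⟩ := mem_vectors.1 hv
    obtain ⟨h3, h4⟩ := mem_vectors.1 hw
    apply alg_ext <;> simp [staticTable_lie, h1, h2, h3, h4]
  mem_J v hv := by simp [mem_vectors, staticTable_lie]
  J_J v hv := by
    obtain ⟨h1, h2⟩ := mem_vectors.1 hv
    apply alg_ext <;> simp [staticTable_lie, gen_apply, h1, h2]
  span := exists_torus_add_vectors

theorem staticTable_lie_mem_vectors (x v : (staticTable c).Alg) : ⁅x, v⁆ ∈ vectors _ := by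
  simp [mem_vectors, staticTable_lie]

theorem finrank_ideal_staticTable_lt (I : LieIdeal ℝ (staticTable c).Alg)
    (F : LinearMap.BilinForm ℝ (staticTable c).Alg) (hF : IsInvariantMetricOn I F) :
    Module.finrank ℝ I ≤ 3 := by
  have h := (isRotationSplit_staticTable c).finrank_lt
    (fun v _ => staticTable_lie_mem_vectors c _ v) (v := gen _ (P 0))
    (by simp [mem_vectors, gen_apply]) (fun h0 => by
      have := congrFun h0 (P 0)
      rw [KleinTable.zero_apply] at this
      simp [gen_apply] at this) hF
  rw [finrank_alg, card_eq] at h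
  omega

/-- `H` is the identity on `V`, and the identity of a nonzero space is not skew for any metric. -/
theorem eq_zero_of_mem_ideal_torsionalStatic {I : LieIdeal ℝ (staticTable 1).Alg}
    {F : LinearMap.BilinForm ℝ (staticTable 1).Alg} (hF : IsInvariantMetricOn I F)
    {x : (staticTable 1).Alg} (hx : x ∈ I) : x = 0 := by
  have hI : ∀ {y}, y ∈ I → y ∈ vectors (staticTable 1) := fun hy =>
    (isRotationSplit_staticTable 1).ideal_le hF
    (fun v _ => staticTable_lie_mem_vectors 1 _ v) (fun r s h => by
      have hP := h (gen _ (P 0)) (by simp [mem_vectors, gen_apply])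
      have h1 := congrFun hP (P 0)
      have h2 := congrFun hP (P 1)
      rw [KleinTable.zero_apply] at h1 h2
      simp [staticTable_lie, gen_apply] at h1 h2
      exact ⟨h2, h1⟩) hy
  have hH : ∀ {y}, y ∈ vectors (staticTable 1) → ⁅gen (staticTable 1) H, y⁆ = y := fun hy => by
    obtain ⟨h1, h2⟩ := mem_vectors.1 hy
    apply alg_ext <;> simp [staticTable_lie, gen_apply, h1, h2]
  -- The quadratic relation is `H² = H`; its skew part says `[H, x] = 0`.
  have h := (isRotationSplit_staticTable 1).linear_relation hF (fun _ => hI)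
    (α := 0) (β := 1) (β' := 0) (α' := 0) (fun v hv => by simp [hH hv]) hx
  simpa [hH (hI hx)] using h

theorem not_hasCentralTheory_torsionalStatic (b : LieSubalgebra ℝ (staticTable 1).Alg) (n : ℕ) :
    ¬HasCentralTheory b n := by
  refine not_hasCentralTheory (fun I F hF => ⟨gen _ J, gen _ (P 0), fun h => ?_⟩) n
  have h1 := congrFun (eq_zero_of_mem_ideal_torsionalStatic hF h) (P 1)
  rw [KleinTable.zero_apply] at h1
  simp [staticTable_lie, gen_apply] at h1

theorem isMinimalAdded_torsionalStatic (b : LieSubalgebra ℝ (staticTable 1).Alg) :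
    IsMinimalAdded b 4 := by
  have h4 : Module.finrank ℝ (staticTable 1).Alg = 4 := finrank_alg _
  have hD := (hasCoadjointTheory b).hasDoubleExtensionTheory
  rw [h4] at hD
  exact hD.isMinimalAdded (d := 0) h4 fun I F hF => finrank_le_of_coord Fin.elim0 I.toSubmodule
    fun x hx _ => eq_zero_of_mem_ideal_torsionalStatic hF hx

/-- The ideal spanned by the translations in space and time. -/
def translationIdeal : LieIdeal ℝ (staticTable 0).Alg where
  carrier := {x | x J = 0}
  add_mem' {x y} hx hy := by simp_all
  zero_mem' := rfl
  smul_mem' r x hx := by simp_all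
  lie_mem {x v} _ := (staticTable_lie_mem_vectors 0 x v).1

theorem isInvariantMetricOn_translationIdeal :
    IsInvariantMetricOn translationIdeal ((staticTable 0).form (formMatrix 0 0 1 1)) where
  symm x _ y _ := by
    simp only [form_formMatrix]
    ring
  inv z x hx y hy := by
    have h1 : x J = 0 := hx
    have h2 : y J = 0 := hy
    simp only [form_formMatrix, staticTable_lie, h1, h2]
    ring
  nondeg x hx h := by
    have hg : ∀ {i}, i ≠ J → gen _ i ∈ translationIdeal := fun h1 => by
      change gen _ _ J = 0
      simp [gen_apply, h1.symm]
    have e0 := h _ (hg (i := H) (by simp))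
    have e1 := h _ (hg (i := P 0) (by simp))
    have e2 := h _ (hg (i := P 1) (by simp))
    simp [form_formMatrix, gen_apply] at e0 e1 e2
    exact alg_ext hx e0 e1 e2

/-- The span of the rotation. -/
def aristotelianRotation : LieSubalgebra ℝ (staticTable 0).Alg where
  carrier := {x | x H = 0 ∧ x (P 0) = 0 ∧ x (P 1) = 0}
  add_mem' {x y} hx hy := by simp_all
  zero_mem' := ⟨rfl, rfl, rfl⟩
  smul_mem' r x hx := by simp_all
  lie_mem' {x y} hx hy := by simp_all [staticTable_lie]

theorem finrank_aristotelianRotation : Module.finrank ℝ aristotelianRotation = 1 := by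
  refine finrank_eq_of_coord ![J] aristotelianRotation.toSubmodule (fun x hx h => ?_) fun y => ?_
  · obtain ⟨h1, h2, h3⟩ := hx
    exact alg_ext (h 0) h1 h2 h3
  · refine ⟨y 0 • gen _ J, ⟨?_, ?_, ?_⟩, fun i => ?_⟩
    on_goal 4 => obtain rfl := Subsingleton.elim i 0
    all_goals simp [gen_apply]

theorem hasCentralDoubleExtensionTheory_aristotelianStatic
    (b : LieSubalgebra ℝ (staticTable 0).Alg) : HasCentralDoubleExtensionTheory b 1 := by
  rw [← finrank_aristotelianRotation]
  refine hasCentralDoubleExtensionTheory_of_ideal b isInvariantMetricOn_translationIdeal _ ?_ ?_ ?_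
  · intro x
    refine ⟨x - x J • gen _ J, ?_, x J • gen _ J, ⟨?_, ?_, ?_⟩, by abel⟩
    · change (x - x J • gen (staticTable 0) J) J = 0
      simp [gen_apply]
    all_goals simp [gen_apply]
  · rintro x h1 ⟨h2, h3, h4⟩
    exact alg_ext h1 h2 h3 h4
  · rintro x ⟨h1, h2, h3⟩ y ⟨h4, h5, h6⟩
    apply alg_ext <;> simp_all [staticTable_lie]

end Static

/-! ### Minimal numbers and assembly -/

theorem limitTable_zero_isMinimalAdded {l t : ℝ} (hlt : l ≠ 0 ∨ t ≠ 0)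
    (b : LieSubalgebra ℝ (limitTable l t 0).Alg) : IsMinimalAdded b 2 :=
  (hasCentralDoubleExtensionTheory_limitTable l t b).hasDoubleExtensionTheory.isMinimalAdded
    (d := 4) (KleinTable.finrank_alg _) (finrank_ideal_limitTable_le l t hlt)

theorem limitTable_static_isMinimalAdded (b : LieSubalgebra ℝ (limitTable 0 0 0).Alg) :
    IsMinimalAdded b 1 :=
  (hasCentralDoubleExtensionTheory_limitTable_static b).hasDoubleExtensionTheory.isMinimalAdded
    (d := 5) (KleinTable.finrank_alg _) (finrank_ideal_limitTable_lt 0 0)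

theorem aristotelianStatic_isMinimalAdded (b : LieSubalgebra ℝ aristotelianStatic.Alg) :
    IsMinimalAdded b 1 :=
  (hasCentralDoubleExtensionTheory_aristotelianStatic b).hasDoubleExtensionTheory.isMinimalAdded
    (d := 3) (KleinTable.finrank_alg _) (finrank_ideal_staticTable_lt 0)

theorem limitSpacetime_zero (η₀ η₁ : ℤˣ) (Λ τ : ℝ) :
    limitSpacetime η₀ η₁ Λ τ 0 = limitTable (-(η₁ : ℤ) * Λ ^ 2) (-(η₀ : ℤ) * τ ^ 2) 0 := by
  rw [limitSpacetime, zero_pow two_ne_zero]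

theorem generalInvariantForm_limitSpacetime (η₀ η₁ : ℤˣ) (Λ τ : ℝ) {c : ℝ} (hc : c ≠ 0) :
    GeneralInvariantForm (limitSpacetime η₀ η₁ Λ τ c)
      (fun p : ℝ × ℝ => KinGen.formMatrix (-p.2) (-p.1) (-((η₀ : ℤ) * (η₁ : ℤ) * Λ ^ 2 * τ ^ 2 * p.2))
            (-(η₀ : ℤ) * c ^ 2 * τ ^ 2 * p.2) (-(η₁ : ℤ) * c ^ 2 * Λ ^ 2 * p.2) (c ^ 2 * p.1) 0)
      (fun p => p.1 ^ 2 - (η₀ : ℤ) * (η₁ : ℤ) * Λ ^ 2 * τ ^ 2 * p.2 ^ 2 ≠ 0) := by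
  refine (generalInvariantForm_limitTable (pow_ne_zero 2 hc)).reparametrize
    Function.surjective_id ?_ ?_
  · rintro ⟨μ, χ⟩
    simp only [id]
    congr 1 <;> ring
  · rintro ⟨μ, χ⟩
    simp only [id]
    rw [show -((η₁ : ℤ) : ℝ) * Λ ^ 2 * (-((η₀ : ℤ) : ℝ) * τ ^ 2) * χ ^ 2 =
      (η₀ : ℤ) * (η₁ : ℤ) * Λ ^ 2 * τ ^ 2 * χ ^ 2 by ring]

theorem exists_eq_torsionalTable {T : KleinTable KinGen}
    (hT : (∃ γ : ℝ, -1 < γ ∧ γ ≤ 1 ∧ T = torsionalGalileanDS γ) ∨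
      (∃ χ : ℝ, 0 < χ ∧ T = torsionalGalileanAdS χ) ∨
      (∃ γ χ : ℝ, -1 ≤ γ ∧ γ ≤ 1 ∧ 0 < χ ∧ T = torsionalGalileanS12 γ χ)) :
    ∃ α β β' α' : ℝ, (β ≠ 0 ∨ α' ≠ 0) ∧ T = torsionalTable α β β' α' := by
  obtain ⟨γ, h1, -, rfl⟩ | ⟨χ, hχ, rfl⟩ | ⟨γ, χ, -, -, hχ, rfl⟩ := hT
  · exact ⟨_, _, _, _, Or.inl (by linarith), rfl⟩
  · exact ⟨_, _, _, _, Or.inl (by positivity), rfl⟩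
  · exact ⟨_, _, _, _, Or.inr hχ.ne', rfl⟩

/-- The dS type with `γ = 0` is the member `χ = 0` of the family of S12 with `γ = 0`; `-0` is kept
to match that family. -/
theorem torsionalGalileanDS_zero : torsionalGalileanDS 0 = torsionalTable 0 1 (-0) 0 := by
  rw [torsionalGalileanDS, add_zero, neg_zero]

theorem torsionalGalileanS12_zero (χ : ℝ) :
    torsionalGalileanS12 0 χ = torsionalTable 0 1 (-χ) χ := by
  rw [torsionalGalileanS12, add_zero]

theorem mainTheorem1 :
    -- limits of (anti-)de Sitter space, relativistic and carrollian: no extension is needed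
    (∀ (η₀ η₁ : ℤˣ) (Λ τ c : ℝ), c ≠ 0 →
      GeneralInvariantForm (limitSpacetime η₀ η₁ Λ τ c)
        (fun p : ℝ × ℝ => match p with
          | (μ, χ) => KinGen.formMatrix (-χ) (-μ) (-((η₀ : ℤ) * (η₁ : ℤ) * Λ ^ 2 * τ ^ 2 * χ))
              (-(η₀ : ℤ) * c ^ 2 * τ ^ 2 * χ) (-(η₁ : ℤ) * c ^ 2 * Λ ^ 2 * χ) (c ^ 2 * μ) 0)
        (fun p => match p with
          | (μ, χ) => μ ^ 2 - (η₀ : ℤ) * (η₁ : ℤ) * Λ ^ 2 * τ ^ 2 * χ ^ 2 ≠ 0) ∧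
      HasInvariantMetric (limitSpacetime η₀ η₁ Λ τ c).Alg ∧
      IsMinimalAdded (limitSpacetime η₀ η₁ Λ τ c).isotropy 0) ∧
    -- limits of (anti-)de Sitter space, nonrelativistic
    (∀ (η₀ η₁ : ℤˣ) (Λ τ : ℝ),
      GeneralInvariantForm (limitSpacetime η₀ η₁ Λ τ 0)
        (fun p : ℝ × ℝ × ℝ => match p with
          | (μ, χ, χH) => KinGen.formMatrix (-χ) (-μ) χH 0 0 0 0)
        (fun _ => False) ∧
      ¬HasInvariantMetric (limitSpacetime η₀ η₁ Λ τ 0).Alg ∧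
      (Λ ≠ 0 ∨ τ ≠ 0 →
        HasCentralDoubleExtensionTheory (limitSpacetime η₀ η₁ Λ τ 0).isotropy 2 ∧
        IsMinimalAdded (limitSpacetime η₀ η₁ Λ τ 0).isotropy 2) ∧
      (Λ = 0 ∧ τ = 0 →
        HasCentralDoubleExtensionTheory (limitSpacetime η₀ η₁ Λ τ 0).isotropy 1 ∧
        IsMinimalAdded (limitSpacetime η₀ η₁ Λ τ 0).isotropy 1)) ∧
    -- torsional galilean spacetimes
    (∀ T : KleinTable KinGen,
      ((∃ γ : ℝ, -1 < γ ∧ γ ≤ 1 ∧ T = torsionalGalileanDS γ) ∨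
        (∃ χ : ℝ, 0 < χ ∧ T = torsionalGalileanAdS χ) ∨
        (∃ γ χ : ℝ, -1 ≤ γ ∧ γ ≤ 1 ∧ 0 < χ ∧ T = torsionalGalileanS12 γ χ)) →
      GeneralInvariantForm T
        (fun p : ℝ × ℝ × ℝ => match p with
          | (χJ, χJH, χH) => KinGen.formMatrix χJ χJH χH 0 0 0 0)
        (fun _ => False) ∧
      ¬HasInvariantMetric T.Alg ∧
      (∀ n, ¬HasCentralTheory T.isotropy n) ∧
      HasCoadjointTheory T.isotropy) ∧
    -- the minimal number for them: the coadjoint extension is minimal, except for `γ = 0`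
    (∀ γ : ℝ, -1 < γ → γ ≤ 1 → γ ≠ 0 → IsMinimalAdded (torsionalGalileanDS γ).isotropy 6) ∧
    (HasDoubleExtensionTheory (torsionalGalileanDS 0).isotropy 4 ∧
      IsMinimalAdded (torsionalGalileanDS 0).isotropy 4) ∧
    (∀ χ : ℝ, 0 < χ → IsMinimalAdded (torsionalGalileanAdS χ).isotropy 6) ∧
    (∀ γ χ : ℝ, -1 ≤ γ → γ ≤ 1 → γ ≠ 0 → 0 < χ →
      IsMinimalAdded (torsionalGalileanS12 γ χ).isotropy 6) ∧
    (∀ χ : ℝ, 0 < χ →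
      HasDoubleExtensionTheory (torsionalGalileanS12 0 χ).isotropy 4 ∧
      IsMinimalAdded (torsionalGalileanS12 0 χ).isotropy 4) ∧
    -- carrollian light cone
    (GeneralInvariantForm lightCone
        (fun p : ℝ × ℝ => match p with
          | (μ, χ) => KinGen.formMatrix χ μ (-χ) 0 0 (-μ) χ)
        (fun p => match p with
          | (μ, χ) => μ ≠ 0 ∨ χ ≠ 0) ∧
      HasInvariantMetric lightCone.Alg ∧ IsMinimalAdded lightCone.isotropy 0) ∧
    -- aristotelian static spacetime
    (GeneralInvariantForm aristotelianStatic
        (fun p : ℝ × ℝ × ℝ => match p with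
          | (χJ, χJH, χH) => AriGen.formMatrix χJ χJH χH 0)
        (fun _ => False) ∧
      ¬HasInvariantMetric aristotelianStatic.Alg ∧
      HasCentralDoubleExtensionTheory aristotelianStatic.isotropy 1 ∧
      IsMinimalAdded aristotelianStatic.isotropy 1) ∧
    -- torsional static spacetime
    (GeneralInvariantForm torsionalStatic
        (fun p : ℝ × ℝ × ℝ => match p with
          | (χJ, χJH, χH) => AriGen.formMatrix χJ χJH χH 0)
        (fun _ => False) ∧
      ¬HasInvariantMetric torsionalStatic.Alg ∧
      (∀ n, ¬HasCentralTheory torsionalStatic.isotropy n) ∧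
      HasCoadjointTheory torsionalStatic.isotropy ∧
      IsMinimalAdded torsionalStatic.isotropy 4) ∧
    -- product of a line with the hyperbolic plane or the sphere
    (∀ σ : ℤˣ,
      GeneralInvariantForm (lineTimesSurface σ)
        (fun p : ℝ × ℝ => match p with
          | (χ, χH) => AriGen.formMatrix χ 0 χH ((σ : ℤ) * χ))
        (fun p => match p with
          | (χ, χH) => χ ≠ 0 ∧ χH ≠ 0) ∧
      HasInvariantMetric (lineTimesSurface σ).Alg ∧
      IsMinimalAdded (lineTimesSurface σ).isotropy 0) ∧
    -- the spacetime A24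
    (GeneralInvariantForm spacetimeA24
        (fun p : ℝ × ℝ => match p with
          | (χ, χJ) => AriGen.formMatrix χJ χ 0 χ)
        (fun p => match p with
          | (χ, _) => χ ≠ 0) ∧
      HasInvariantMetric spacetimeA24.Alg ∧ IsMinimalAdded spacetimeA24.isotropy 0) := by
  refine ⟨fun η₀ η₁ Λ τ c hc => ?_, fun η₀ η₁ Λ τ => ?_, fun T hT => ?_, fun γ h1 _ h0 => ?_,
    ?_, fun χ hχ => ?_, fun γ χ _ _ h0 hχ => ?_, fun χ _ => ?_, ?_, ?_, ?_, fun σ => ?_, ?_⟩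
  · have h := generalInvariantForm_limitSpacetime η₀ η₁ Λ τ hc
    -- With `μ = 1`, `χ = 0` the nondegeneracy condition reads `1 ≠ 0`, for all values of `Λ` and
    -- `τ`.
    have hm := h.hasInvariantMetric (p := (1, 0)) (by simp)
    exact ⟨h, hm, hm.isMinimalAdded _⟩
  · rw [limitSpacetime_zero]
    have h := generalInvariantForm_limitTable_zero (-(η₁ : ℤ) * Λ ^ 2) (-(η₀ : ℤ) * τ ^ 2)
    -- The change of parameters from `(μ, χ, χH)` to the entries `(-χ, -μ, χH)` is an involution,
    -- hence surjective.
    refine ⟨h.reparametrize (f := fun p => (-p.2.1, -p.1, p.2.2)) (fun p =>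
        ⟨(-p.2.1, -p.1, p.2.2), by simp⟩) (fun _ => rfl) (fun _ => Iff.rfl),
      h.not_hasInvariantMetric, fun hne => ?_, fun hne => ?_⟩
    · exact ⟨hasCentralDoubleExtensionTheory_limitTable _ _ _,
        limitTable_zero_isMinimalAdded (hne.imp (fun h => by simp [h]) fun h => by simp [h]) _⟩
    · obtain ⟨rfl, rfl⟩ := hne
      rw [zero_pow two_ne_zero, mul_zero, mul_zero]
      exact ⟨hasCentralDoubleExtensionTheory_limitTable_static _,
        limitTable_static_isMinimalAdded _⟩
  · obtain ⟨α, β, β', α', h, rfl⟩ := exists_eq_torsionalTable hT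
    have hf := generalInvariantForm_torsionalTable α β β' α'
    exact ⟨hf, hf.not_hasInvariantMetric, not_hasCentralTheory_torsionalTable h _,
      hasCoadjointTheory _⟩
  · refine isMinimalAdded_torsionalTable ?_ _
    have : 1 + γ ≠ 0 := by linarith
    simp [this, h0]
  · rw [torsionalGalileanDS_zero]
    exact ⟨hasDoubleExtensionTheory_torsionalTable 0 _, isMinimalAdded_torsionalTable_elliptic 0 _⟩
  · refine isMinimalAdded_torsionalTable ?_ _
    have : 0 < (2 * χ) ^ 2 * (1 + χ ^ 2) := by positivity
    simpa using this.ne'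
  · refine isMinimalAdded_torsionalTable ?_ _
    -- This is the value of `β²α - βα'β' - α'²` for S12.
    have h : γ * ((1 + γ) ^ 2 + χ ^ 2) ≠ 0 := mul_ne_zero h0 (by positivity)
    intro h'
    exact h (by linear_combination h')
  · rw [torsionalGalileanS12_zero]
    exact ⟨hasDoubleExtensionTheory_torsionalTable χ _, isMinimalAdded_torsionalTable_elliptic χ _⟩
  · have h := generalInvariantForm_lightCone
    have hm := h.hasInvariantMetric (p := (1, 0)) (Or.inl one_ne_zero)
    exact ⟨h, hm, hm.isMinimalAdded _⟩
  · have h := generalInvariantForm_staticTable 0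
    exact ⟨h, h.not_hasInvariantMetric, hasCentralDoubleExtensionTheory_aristotelianStatic _,
      aristotelianStatic_isMinimalAdded _⟩
  · have h := generalInvariantForm_staticTable 1
    exact ⟨h, h.not_hasInvariantMetric, not_hasCentralTheory_torsionalStatic _,
      hasCoadjointTheory _, isMinimalAdded_torsionalStatic _⟩
  · have h := generalInvariantForm_curvedTable_J (σ := (σ : ℤ)) (by simp)
    have hm := h.hasInvariantMetric (p := (1, 1)) ⟨one_ne_zero, one_ne_zero⟩
    exact ⟨h, hm, hm.isMinimalAdded _⟩
  · have h := generalInvariantForm_spacetimeA24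
    have hm := h.hasInvariantMetric (p := (1, 0)) one_ne_zero
    exact ⟨h, hm, hm.isMinimalAdded _⟩
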